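/- Conventions. $X$ is a real Banach space with closed unit ball $B_X$; $\omega_1$ is the first uncountable ordinal; $\mathbb N=\{1,2,\dots\}$. Finite subsets of $\mathbb N$ are identified with strictly increasing finite sequences; $F\preceq E$ means that $F$ is an initial segment of $E$, and $F \prec E$ that moreover $F\neq E$; for $n>\max E$ (any $n$ if $E=\varnothing$), $E^\frown n=E\cup\{n\}$. For a family $\mathcal F$ of finite subsets of $\mathbb N$, $MAX(\mathcal F)$ is the set of its $\preceq$-maximal members, $\mathcal F'=\mathcal F\setminus MAX(\mathcal F)$ and $\widehat{\mathcal F}=\mathcal F\setminus\{\varnothing\}$; $\mathcal F$ carries the topology of the Cantor set $\{0,1\}^{\mathbb N}$. Fine Schreier families $(\mathcal F_\xi)_{\xi<\omega_1}$: $\mathcal F_0=\{\varnothing\}$; $\mathcal F_{\xi+1}=\{A\cup B: |A|\le 1,\ B\in\mathcal F_\xi,\ A<B\}$; for a countable limit ordinal $\xi$ one fixes ordinals $\xi_n<\xi$, non-decreasing with supremum $\xi$ and with $\mathcal F_{\xi_n}\subset\mathcal F_{\xi_{n+1}}$, and puts $\mathcal F_\xi=\{E:\exists n\in\mathbb N,\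 n\le\min E,\ E\in\mathcal F_{\xi_n}\}$ (with $n\le\min\varnothing$ for all $n$). Such systems exist; the statement is for any of them. Szlenk index: for a bounded $L\subset X^*$ and $\varepsilon>0$, $s_\varepsilon(L)$ is the set of $x^*\in X^*$ such that $\mathrm{diam}_{\|\cdot\|}(V\cap L)>\varepsilon$ for every $w^*$-neighbourhood $V$ of $x^*$; $s^0_\varepsilon(L)=L$, $s_\varepsilon^{\xi+1}(L)=s_\varepsilon(s_\varepsilon^\xi(L))$, and $s^\xi_\varepsilon(L)=\bigcap_{\zeta<\xi}s^\zeta_\varepsilon(L)$ for limit $\xi$. $Sz_\varepsilon(L)$ is the least $\xi<\omega_1$ with $s^\xi_\varepsilon(L)=\varnothing$, and $\omega_1$ if there is none; $Sz(L)=\sup_{\varepsilon>0}Sz_\varepsilon(L)$. Tree indices: for a set $\sigma$ of infinite sequences in $B_X$ and a set $\mathcal H$ of finite sequences in $B_X$, $(\mathcal H)'_\sigma=\{t\in\mathcal H:\exists (s_i)\in\sigma\ \forall i\ \ t^\frown s_i\in\mathcal H\}$; transfinite derivatives are formed as above, and $I_\sigma(\mathcal H)$ is the least $\xi<\omega_1$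 with $(\mathcal H)^\xi_\sigma=\varnothing$, and $\omega_1$ if there is none. For $\varnothing\ne S\subset X^*$, $I_S$ is $I_\sigma$ with $\sigma$ the set of $(x_n)\subset B_X$ with $x^*(x_n)\to0$ for all $x^*\in S$; $I_{S,r}$ is $I_\sigma$ with $\sigma$ the set of $(x_n)\subset B_X$ with $\limsup_n|x^*(x_n)|\le r$ for all $x^*\in S$; $I_w=I_{B_{X^*}}$. For $K\subset B_{X^*}$, $\mathcal H^K_\varepsilon$ is the set of finite sequences $(x_i)_{i=1}^n$ in $B_X$ for which there is $x^*\in K$ with $x^*(x_i)\ge\varepsilon$ for all $i$. A family $(x_E)_{E\in\widehat{\mathcal F_\xi}}\subset B_X$ is $S$-null if $\lim_n x^*(x_{E^\frown n})=0$ for all $E\in\mathcal F_\xi'$ and $x^*\in S$; a family $(x^*_E)_{E\in\mathcal F_\xi}\subset X^*$ is $w^*$-continuous if $E\mapsto x_E^*$ is continuous from $\mathcal F_\xi$ to the $w^*$-topology. **Lemma.** Let $X$ be a separable Banach space and let $\varnothing\ne K\subset B_{X^*}$ be $w^*$-compact and norm separable. For every $0<\xi<\omega_1$ the following are equivalent.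 (i) There is $\varepsilon>0$ with $Sz_\varepsilon(K)>\xi$. (ii) There is $\varepsilon>0$ such that for every norm separable $\varnothing\ne S\subset X^*$ there exist an $S$-null $(x_E)_{E\in\widehat{\mathcal F_\xi}}\subset B_X$ and a $w^*$-continuous $(x^*_E)_{E\in\mathcal F_\xi}\subset K$ with $x^*_E(x_F)\ge\varepsilon$ whenever $E\in\mathcal F_\xi$ and $\varnothing\prec F\preceq E$. (iii) There is $\varepsilon>0$ such that for every norm separable $\varnothing\ne S\subset X^*$ there exist an $S$-null $(x_E)_{E\in\widehat{\mathcal F_\xi}}\subset B_X$ and $(x^*_E)_{E\in MAX(\mathcal F_\xi)}\subset K$ with $x^*_E(x_F)\ge\varepsilon$ whenever $E\in MAX(\mathcal F_\xi)$ and $\varnothing\prec F\preceq E$. (iv) There is $\varepsilon>0$ such that $I_S(\mathcal H^K_\varepsilon)>\xi$ for every norm separable $\varnothing\neq S\subset X^*$. (v) There are $0<r<\varepsilon$ such that $I_{S,r}(\mathcal H^K_\varepsilon)>\xi$ for every norm separable $\varnothing\ne S\subset X^*$. Moreover, $Sz(K)=\sup_{\varepsilon>0}I_S(\mathcal H^K_\varepsilon)$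 for every norm separable $S\supset K$. If $\ell_1$ does not embed isomorphically into $X$, then (i)–(v) are equivalent for every $0<\xi<\omega_1$ also without the assumption that $K$ is norm separable, and in this case $Sz(K)=\sup_{\varepsilon>0}I_w(\mathcal H^K_\varepsilon)$. -/

import Mathlib

open Filter Topology Set Ordinal

namespace Szlenk

/-! ### Transfinite iteration of a derivation and the associated index -/

/-- The transfinite iterates of a derivation `d` started at `A`:
`A⁰ = A`, `A^(ξ+1) = d (A^ξ)`, and `A^ξ = ⋂_{ζ<ξ} A^ζ` for limit `ξ`. -/
noncomputable def derivIter {α : Type*} (d : Set α → Set α) (A : Set α) (ξ : Ordinal.{0}) :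
    Set α :=
  Ordinal.limitRecOn (motive := fun _ => Set α) ξ A (fun _ B => d B)
    (fun ξ _ ih => ⋂ (ζ : Ordinal.{0}) (h : ζ < ξ), ih ζ h)

/-- The least `ξ < ω₁` whose iterate is empty, and `ω₁` if there is none. -/
noncomputable def derivIndex {α : Type*} (d : Set α → Set α) (A : Set α) : Ordinal.{0} :=
  sInf ({ξ | ξ < ω₁ ∧ derivIter d A ξ = ∅} ∪ {ω₁})

/-! ### Fine Schreier families

Finite subsets of `{1, 2, 3, …}`, identified with strictly increasing finite sequences, are
elements of `Finset ℕ` with positive members. -/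

/-- `𝒜ₙ`: the sets of positive integers with at most `n` elements. -/
def cardFamily (n : ℕ) : Set (Finset ℕ) := {E | E.card ≤ n ∧ ∀ k ∈ E, 1 ≤ k}

/-- `(F, G)`: all unions `A ∪ B` with `A ∈ F`, `B ∈ G` and `A < B`. -/
def famSum (F G : Set (Finset ℕ)) : Set (Finset ℕ) :=
  {E | ∃ A ∈ F, ∃ B ∈ G, (∀ a ∈ A, ∀ b ∈ B, a < b) ∧ E = A ∪ B}

/-- `𝒟(Gₙ)`: all `E` such that `n ≤ min E` and `E ∈ Gₙ` for some `n ≥ 1`. -/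
def diag (G : ℕ → Set (Finset ℕ)) : Set (Finset ℕ) :=
  {E | ∃ n, 1 ≤ n ∧ (∀ k ∈ E, n ≤ k) ∧ E ∈ G n}

/-- `F` restricted to the countable ordinals is a system of fine Schreier families. The families
are determined by the recursion up to the choice, at each countable limit ordinal `ξ`, of a
sequence of ordinals increasing to `ξ` along which the families increase. -/
structure IsFineSchreier (F : Ordinal.{0} → Set (Finset ℕ)) : Prop where
  zero : F 0 = {∅}
  succ : ∀ ξ < ω₁, F (ξ + 1) = famSum (cardFamily 1) (F ξ)
  limit : ∀ ξ < ω₁, Order.IsSuccLimit ξ → ∃ s : ℕ → Ordinal.{0},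
    Monotone s ∧ (∀ n, s n < ξ) ∧ (∀ ζ < ξ, ∃ n, ζ < s n) ∧
    (∀ n, F (s n) ⊆ F (s (n + 1))) ∧ F ξ = diag (fun n => F (s n))

/-! Such systems exist. -/

/-- The recursive requirement at a limit ordinal `ξ` on the sequence `s`. -/
def IsLimitSeq (F : Ordinal.{0} → Set (Finset ℕ)) (ξ : Ordinal.{0}) (s : ℕ → Ordinal.{0}) :
    Prop :=
  Monotone s ∧ (∀ n, s n < ξ) ∧ (∀ ζ < ξ, ∃ n, ζ < s n) ∧ (∀ n, F (s n) ⊆ F (s (n + 1)))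

open Classical in
/-- One system of fine Schreier families, with the sequences at limits picked by choice. -/
noncomputable def someFine (ξ : Ordinal.{0}) : Set (Finset ℕ) :=
  Ordinal.limitRecOn (motive := fun _ => Set (Finset ℕ)) ξ {∅}
    (fun _ B => famSum (cardFamily 1) B)
    (fun ξ _ ih =>
      if h : ∃ s, IsLimitSeq (fun ζ => if hζ : ζ < ξ then ih ζ hζ else ∅) ξ s then
        diag (fun n => if hζ : h.choose n < ξ then ih _ hζ else ∅)
      else ∅)

theorem someFine_zero : someFine 0 = {∅} := by
  simp [someFine]

theorem someFine_succ (ξ : Ordinal.{0}) :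
    someFine (ξ + 1) = famSum (cardFamily 1) (someFine ξ) := by
  simp only [someFine, Ordinal.limitRecOn_add_one]

open Classical in
theorem someFine_limit {ξ : Ordinal.{0}} (hξ : Order.IsSuccLimit ξ)
    (h : ∃ s, IsLimitSeq someFine ξ s) :
    ∃ s, IsLimitSeq someFine ξ s ∧ someFine ξ = diag (fun n => someFine (s n)) := by
  have key : ∀ s, IsLimitSeq (fun ζ => if ζ < ξ then someFine ζ else ∅) ξ s ↔
      IsLimitSeq someFine ξ s := by
    intro s
    constructor
    · rintro ⟨h1, h2, h3, h4⟩
      refine ⟨h1, h2, h3, fun n => ?_⟩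
      simpa [h2 n, h2 (n + 1)] using h4 n
    · rintro ⟨h1, h2, h3, h4⟩
      refine ⟨h1, h2, h3, fun n => ?_⟩
      simpa [h2 n, h2 (n + 1)] using h4 n
  have h' : ∃ s, IsLimitSeq (fun ζ => if ζ < ξ then someFine ζ else ∅) ξ s := by
    obtain ⟨s, hs⟩ := h
    exact ⟨s, (key s).2 hs⟩
  have hc := (key _).1 h'.choose_spec
  refine ⟨h'.choose, hc, ?_⟩
  have e : someFine ξ = if h : ∃ s, IsLimitSeq (fun ζ => if ζ < ξ then someFine ζ else ∅) ξ s then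
        diag (fun n => if h.choose n < ξ then someFine (h.choose n) else ∅)
      else ∅ := by
    rw [someFine, Ordinal.limitRecOn_limit _ _ _ _ hξ]
    rfl
  rw [e, dif_pos h']
  congr 1
  funext n
  rw [if_pos (hc.2.1 n)]

/-- An increasing sequence of suitable ordinals exists below every countable limit ordinal. -/
theorem exists_isLimitSeq {F : Ordinal.{0} → Set (Finset ℕ)} {ξ : Ordinal.{0}} (hξ : ξ < ω₁)
    (h0 : 0 < ξ) (hF : ∀ a < ξ, ∀ b < ξ, ∃ c < ξ, a ≤ c ∧ b < c ∧ F a ⊆ F c) :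
    ∃ s, IsLimitSeq F ξ s := by
  have : Countable (Iio ξ) := by
    rw [← Cardinal.mk_le_aleph0_iff, Cardinal.mk_Iio_ordinal, Cardinal.lift_le_aleph0]
    have := (Cardinal.lt_ord (o := ξ) (c := Cardinal.aleph 1)).1 (by simpa using hξ)
    exact Cardinal.lt_aleph_one_iff.1 this
  have : Nonempty (Iio ξ) := ⟨⟨0, h0⟩⟩
  obtain ⟨t, ht⟩ := exists_surjective_nat (Iio ξ)
  have step : ∀ a b : Iio ξ, ∃ c : Iio ξ, a.1 ≤ c.1 ∧ b.1 < c.1 ∧ F a ⊆ F c := by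
    intro a b
    obtain ⟨c, hc, h⟩ := hF a.1 a.2 b.1 b.2
    exact ⟨⟨c, hc⟩, h⟩
  choose g hg using step
  let u : ℕ → Iio ξ := fun n => Nat.rec ⟨0, h0⟩ (fun n a => g a (t n)) n
  have hu : ∀ n, u (n + 1) = g (u n) (t n) := fun n => rfl
  refine ⟨fun n => (u n).1, monotone_nat_of_le_succ fun n => ?_, fun n => (u n).2, ?_, fun n => ?_⟩
  · rw [hu]; exact (hg _ _).1
  · intro ζ hζ
    obtain ⟨n, hn⟩ := ht ⟨ζ, hζ⟩
    refine ⟨n + 1, ?_⟩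
    change ζ < (u (n + 1)).1
    rw [hu]
    have := (hg (u n) (t n)).2.1
    rw [hn] at this ⊢
    exact this
  · change F (u n).1 ⊆ F (u (n + 1)).1
    rw [hu]; exact (hg _ _).2.2

/-- The induction hypothesis used to construct the families: closed under subsets, members
consist of positive integers, and the earlier families are contained in it up to a tail. -/
theorem someFine_aux (η : Ordinal.{0}) (hη : η < ω₁) :
    (∅ ∈ someFine η) ∧
    (∀ E ∈ someFine η, (∀ k ∈ E, 1 ≤ k) ∧ ∀ G ⊆ E, G ∈ someFine η) ∧
    (∀ ξ ≤ η, ∃ m : ℕ, ∀ E ∈ someFine ξ, (∀ k ∈ E, m ≤ k) → E ∈ someFine η) ∧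
    (Order.IsSuccLimit η → ∃ s, IsLimitSeq someFine η s) := by
  induction η using Ordinal.limitRecOn with
  | zero =>
    refine ⟨by simp [someFine_zero], ?_, ?_, fun h => (h.1 isMin_bot).elim⟩
    · simp [someFine_zero]
    · intro ξ hξ
      obtain rfl : ξ = 0 := by simpa using hξ
      exact ⟨0, fun E hE _ => hE⟩
  | add_one η ih =>
    have hη' : η < ω₁ := lt_of_le_of_lt (le_self_add) hη
    obtain ⟨i1, i2, i3, -⟩ := ih hη'
    have sub : someFine η ⊆ someFine (η + 1) := by
      intro E hE
      rw [someFine_succ]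
      exact ⟨∅, by simp [cardFamily], E, hE, by simp, by simp⟩
    refine ⟨sub i1, ?_, ?_, ?_⟩
    · rw [someFine_succ]
      rintro E ⟨A, hA, B, hB, hAB, rfl⟩
      refine ⟨fun k hk => (Finset.mem_union.1 hk).elim (hA.2 k) ((i2 B hB).1 k), fun G hG => ?_⟩
      refine ⟨A ∩ G, ⟨(Finset.card_le_card Finset.inter_subset_left).trans hA.1,
        fun k hk => hA.2 k (Finset.mem_inter.1 hk).1⟩, B ∩ G,
        (i2 B hB).2 _ Finset.inter_subset_left, ?_, ?_⟩
      · intro a ha b hb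
        exact hAB a (Finset.mem_inter.1 ha).1 b (Finset.mem_inter.1 hb).1
      · rw [← Finset.union_inter_distrib_right, Finset.inter_eq_right.2 hG]
    · intro ξ hξ
      rcases hξ.lt_or_eq with h | rfl
      · obtain ⟨m, hm⟩ := i3 ξ (by simpa using Order.lt_add_one_iff.1 h)
        exact ⟨m, fun E hE hk => sub (hm E hE hk)⟩
      · exact ⟨0, fun E hE _ => hE⟩
    · intro h
      exact absurd h (by simp)
  | limit η hlim ih =>
    have h0 : 0 < η := hlim.bot_lt
    -- moving a tail inclusion down to an inclusion at the cost of finitely many successors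
    have shift : ∀ a < η, ∀ m : ℕ, ∀ c < η,
        (∀ E ∈ someFine a, (∀ k ∈ E, m ≤ k) → E ∈ someFine c) →
        ∃ d < η, c ≤ d ∧ someFine a ⊆ someFine d := by
      intro a ha m
      induction m with
      | zero => exact fun c hc h => ⟨c, hc, le_rfl, fun E hE => h E hE (by simp)⟩
      | succ m ihm =>
        intro c hc h
        have hc1 : c + 1 < η := hlim.add_one_lt hc
        rcases Nat.eq_zero_or_pos m with rfl | hm
        · exact ⟨c, hc, le_rfl, fun E hE => h E hE
            (((ih a ha (ha.trans hη)).2.1 E hE).1)⟩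
        obtain ⟨d, hd, hcd, hs⟩ := ihm (c + 1) hc1 (by
          intro E hE hk
          rw [someFine_succ]
          refine ⟨E.filter (· = m), ⟨?_, ?_⟩, E.filter (· ≠ m), ?_, ?_, ?_⟩
          · exact Finset.card_le_one.2 (by simp; grind)
          · intro k hk'
            have := (Finset.mem_filter.1 hk').2
            omega
          · apply h _ (((ih a ha (ha.trans hη)).2.1 E hE).2 _ (Finset.filter_subset _ _))
            intro k hk'
            have h1 := Finset.mem_filter.1 hk'
            have h2 := hk k h1.1
            have h3 := h1.2
            omega
          · intro x hx y hy
            have h1 := Finset.mem_filter.1 hx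
            have h2 := Finset.mem_filter.1 hy
            have h3 := hk y h2.1
            have h4 := h1.2
            have h5 := h2.2
            omega
          · ext k; simp; grind)
        exact ⟨d, hd, le_trans (le_self_add) hcd, hs⟩
    have hseq : ∃ s, IsLimitSeq someFine η s := by
      refine exists_isLimitSeq hη h0 fun a ha b hb => ?_
      have hc : max a (b + 1) < η := max_lt ha (hlim.add_one_lt hb)
      obtain ⟨m, hm⟩ := (ih _ hc (hc.trans hη)).2.2.1 a (le_max_left _ _)
      obtain ⟨d, hd, hcd, hs⟩ := shift a ha m _ hc hm
      exact ⟨d, hd, (le_max_left _ _).trans hcd,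
        lt_of_lt_of_le (lt_of_lt_of_le (by simp) (le_max_right a (b + 1))) hcd, hs⟩
    obtain ⟨s, hs, he⟩ := someFine_limit hlim hseq
    refine ⟨?_, ?_, ?_, fun _ => hseq⟩
    · rw [he]
      exact ⟨1, le_rfl, by simp, (ih _ (hs.2.1 1) ((hs.2.1 1).trans hη)).1⟩
    · rw [he]
      rintro E ⟨n, hn, hk, hE⟩
      have h1 := (ih _ (hs.2.1 n) ((hs.2.1 n).trans hη)).2.1 E hE
      exact ⟨h1.1, fun G hG => ⟨n, hn, fun k hk' => hk k (hG hk'), h1.2 G hG⟩⟩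
    · intro ξ hξ
      rcases hξ.lt_or_eq with h | rfl
      · obtain ⟨n, hn⟩ := hs.2.2.1 ξ h
        have hn' : ξ ≤ s (n + 1) := hn.le.trans (hs.1 (Nat.le_succ n))
        obtain ⟨m, hm⟩ := (ih _ (hs.2.1 (n + 1)) ((hs.2.1 (n + 1)).trans hη)).2.2.1 ξ hn'
        refine ⟨max m (n + 1), fun E hE hk => ?_⟩
        rw [he]
        exact ⟨n + 1, by omega, fun k hk' => (le_max_right _ _).trans (hk k hk'),
          hm E hE fun k hk' => (le_max_left _ _).trans (hk k hk')⟩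
      · exact ⟨0, fun E hE _ => hE⟩

/-- Systems of fine Schreier families exist. -/
theorem exists_isFineSchreier : ∃ F, IsFineSchreier F := by
  refine ⟨someFine, someFine_zero, fun ξ _ => someFine_succ ξ, fun ξ hξ hlim => ?_⟩
  obtain ⟨s, hs, he⟩ := someFine_limit hlim ((someFine_aux ξ hξ).2.2.2 hlim)
  exact ⟨s, hs.1, hs.2.1, hs.2.2.1, hs.2.2.2, he⟩

/-! ### Trees indexed by families of finite sets -/

/-- `F ⪯ E`: `F` is an initial segment of `E`. -/
def IsPrefix (F E : Finset ℕ) : Prop := F ⊆ E ∧ ∀ a ∈ F, ∀ b ∈ E \ F, a < b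

/-- `MAX(F)`: the members of `F` that have no proper extension in `F`. -/
def maxMembers (F : Set (Finset ℕ)) : Set (Finset ℕ) :=
  {E | E ∈ F ∧ ∀ G ∈ F, IsPrefix E G → G = E}

/-- The topology on finite subsets of `ℕ` inherited from the Cantor set `{0,1}^ℕ`. -/
abbrev cantorTopology : TopologicalSpace (Finset ℕ) :=
  TopologicalSpace.induced (fun (E : Finset ℕ) (n : ℕ) => decide (n ∈ E)) inferInstance

section Banach

variable {X : Type*} [NormedAddCommGroup X] [NormedSpace ℝ X]

/-- `(x_E)`, `E ∈ F`, `E ≠ ∅`, is an `S`-null tree in the unit ball: for every non-maximal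
`E ∈ F` the immediate successors `x_{E⌢n}` converge to `0` pointwise on `S`. (In the families
considered here `E⌢n ∈ F` for all large `n` whenever `E` is not maximal; the values of `x`
at other arguments are irrelevant.) -/
def IsNullTree (S : Set (StrongDual ℝ X)) (F : Set (Finset ℕ)) (x : Finset ℕ → X) : Prop :=
  (∀ E ∈ F, E ≠ ∅ → ‖x E‖ ≤ 1) ∧
  ∀ E ∈ F \ maxMembers F, ∀ f ∈ S, Tendsto (fun n : ℕ => f (x (insert n E))) atTop (𝓝 0)

/-- A family of functionals `(y_E)`, `E ∈ F`, is w*-continuous: `E ↦ y_E` is continuous from `F`,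
as a subspace of the Cantor set, to the weak* topology. -/
def IsWeakStarContinuous (F : Set (Finset ℕ)) (y : Finset ℕ → StrongDual ℝ X) : Prop :=
  @ContinuousOn (Finset ℕ) (WeakDual ℝ X) cantorTopology _
    (fun E => StrongDual.toWeakDual (y E)) F

/-- Weak* compactness of a set of functionals. -/
def IsWeakStarCompact (K : Set (StrongDual ℝ X)) : Prop :=
  IsCompact ((fun f : StrongDual ℝ X => StrongDual.toWeakDual f) '' K)

/-! ### The Szlenk index -/

/-- The Szlenk derivation `s_ε(L)`: the functionals all of whose weak* neighbourhoods `V` satisfy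
`diam (V ∩ L) > ε`, the diameter being taken in the norm. -/
def szlenkDeriv (ε : ℝ) (L : Set (StrongDual ℝ X)) : Set (StrongDual ℝ X) :=
  {f | ∀ V ∈ 𝓝 (StrongDual.toWeakDual f),
    ENNReal.ofReal ε < Metric.ediam {g | StrongDual.toWeakDual g ∈ V ∧ g ∈ L}}

/-- `Sz_ε(L)`. -/
noncomputable def szlenkIndexAt (ε : ℝ) (L : Set (StrongDual ℝ X)) : Ordinal.{0} :=
  derivIndex (szlenkDeriv ε) L

/-- `Sz(L) = sup_{ε > 0} Sz_ε(L)`; the supremum is bounded by `ω₁`. -/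
noncomputable def szlenkIndex (L : Set (StrongDual ℝ X)) : Ordinal.{0} :=
  ⨆ ε : {ε : ℝ // 0 < ε}, szlenkIndexAt ε.1 L

/-! ### Indices of trees of vectors -/

/-- The `σ`-derivative of a tree `H` of finite sequences. -/
def seqDeriv {α : Type*} (σ : Set (ℕ → α)) (H : Set (List α)) : Set (List α) :=
  {t | t ∈ H ∧ ∃ s ∈ σ, ∀ i, t ++ [s i] ∈ H}

/-- The `σ`-index `I_σ(H)`. -/
noncomputable def seqIndex {α : Type*} (σ : Set (ℕ → α)) (H : Set (List α)) : Ordinal.{0} :=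
  derivIndex (seqDeriv σ) H

/-- The sequences in the unit ball that are pointwise null on `S`. -/
def nullSeqs (S : Set (StrongDual ℝ X)) : Set (ℕ → X) :=
  {x | (∀ n, ‖x n‖ ≤ 1) ∧ ∀ f ∈ S, Tendsto (fun n => f (x n)) atTop (𝓝 0)}

/-- The sequences in the unit ball that have `S` radius `r`. -/
def radiusSeqs (S : Set (StrongDual ℝ X)) (r : ℝ) : Set (ℕ → X) :=
  {x | (∀ n, ‖x n‖ ≤ 1) ∧ ∀ f ∈ S, limsup (fun n => |f (x n)|) atTop ≤ r}

/-- `I_S(H)`, the pointwise null on `S` index. -/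
noncomputable def nullIndex (S : Set (StrongDual ℝ X)) (H : Set (List X)) : Ordinal.{0} :=
  seqIndex (nullSeqs S) H

/-- `I_{S,r}(H)`, the radius `r` version. -/
noncomputable def radiusIndex (S : Set (StrongDual ℝ X)) (r : ℝ) (H : Set (List X)) :
    Ordinal.{0} :=
  seqIndex (radiusSeqs S r) H

/-- `I_w(H)`, the weakly null index: the case where `S` is the dual unit ball. -/
noncomputable def weakIndex (H : Set (List X)) : Ordinal.{0} :=
  nullIndex {f : StrongDual ℝ X | ‖f‖ ≤ 1} H

/-- `ℋ^K_ε`: the finite sequences in the unit ball on all of whose terms a single member of `K`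
takes values at least `ε`. -/
def normedTree (K : Set (StrongDual ℝ X)) (ε : ℝ) : Set (List X) :=
  {l | (∀ x ∈ l, ‖x‖ ≤ 1) ∧ ∃ f ∈ K, ∀ x ∈ l, ε ≤ f x}

variable (X) in
/-- `ℓ₁` embeds isomorphically into `X`. -/
def ContainsL1 : Prop :=
  ∃ T : lp (fun _ : ℕ => ℝ) 1 →L[ℝ] X, ∃ c : ℝ, 0 < c ∧ ∀ a, c * ‖a‖ ≤ ‖T a‖

/-! ### The five conditions

Here `ξ` is a countable ordinal and `F` stands for the fine Schreier family `ℱ_ξ`. -/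

/-- `Sz_ε(K) > ξ` for some `ε > 0`. -/
def condSzlenk (K : Set (StrongDual ℝ X)) (ξ : Ordinal.{0}) : Prop :=
  ∃ ε : ℝ, 0 < ε ∧ ξ < szlenkIndexAt ε K

/-- For some `ε > 0` and every nonempty norm separable `S ⊆ X*` there are an `S`-null tree
`(x_E)`, `∅ ≠ E ∈ F`, and a w*-continuous `(y_E)`, `E ∈ F`, in `K` such that `y_E(x_G) ≥ ε`
whenever `∅ ≺ G ⪯ E ∈ F`. -/
def condTreeCont (K : Set (StrongDual ℝ X)) (F : Set (Finset ℕ)) : Prop :=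
  ∃ ε : ℝ, 0 < ε ∧ ∀ S : Set (StrongDual ℝ X), S.Nonempty → TopologicalSpace.IsSeparable S →
    ∃ (x : Finset ℕ → X) (y : Finset ℕ → StrongDual ℝ X), IsNullTree S F x ∧
      (∀ E ∈ F, y E ∈ K) ∧ IsWeakStarContinuous F y ∧
      ∀ E ∈ F, ∀ G, IsPrefix G E → G ≠ ∅ → ε ≤ y E (x G)

/-- The same with functionals only at the maximal members of `F` and no continuity. -/
def condTreeMax (K : Set (StrongDual ℝ X)) (F : Set (Finset ℕ)) : Prop :=
  ∃ ε : ℝ, 0 < ε ∧ ∀ S : Set (StrongDual ℝ X), S.Nonempty → TopologicalSpace.IsSeparable S →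
    ∃ (x : Finset ℕ → X) (y : Finset ℕ → StrongDual ℝ X), IsNullTree S F x ∧
      (∀ E ∈ maxMembers F, y E ∈ K) ∧
      ∀ E ∈ maxMembers F, ∀ G, IsPrefix G E → G ≠ ∅ → ε ≤ y E (x G)

/-- For some `ε > 0`, `I_S(ℋ^K_ε) > ξ` for every nonempty norm separable `S ⊆ X*`. -/
def condNullIndex (K : Set (StrongDual ℝ X)) (ξ : Ordinal.{0}) : Prop :=
  ∃ ε : ℝ, 0 < ε ∧ ∀ S : Set (StrongDual ℝ X), S.Nonempty → TopologicalSpace.IsSeparable S →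
    ξ < nullIndex S (normedTree K ε)

/-- For some `0 < r < ε`, `I_{S,r}(ℋ^K_ε) > ξ` for every nonempty norm separable `S ⊆ X*`. -/
def condRadiusIndex (K : Set (StrongDual ℝ X)) (ξ : Ordinal.{0}) : Prop :=
  ∃ r ε : ℝ, 0 < r ∧ r < ε ∧
    ∀ S : Set (StrongDual ℝ X), S.Nonempty → TopologicalSpace.IsSeparable S →
      ξ < radiusIndex S r (normedTree K ε)

end Banach

end Szlenk

namespace Szlenk

/-! ### Iterated derivations -/

section Derivations

variable {α : Type*} (d : Set α → Set α) (A : Set α)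

/-! Two derivations are compared by transfinite induction: the Szlenk derivation on sets of
functionals and the tree derivation on sets of lists of vectors.

From functionals to vectors: if `f` lies in `s_ε(L)`, then weak* near `f` there are `h ∈ L` at norm
distance more than `ε / 2` from `f`. Take a unit vector almost norming `h - f`, subtract a point of
a finite net that agrees with it on finitely many functionals, and halve: this gives `x` in the
ball, almost annihilated by those functionals, with `h x > ε / 5`
(`exists_near_of_mem_szlenkDeriv`). The members of `F ξ` with least element `n`, if there are any,
copy the part above `n` of an earlier family `F ζ` (`section_eq`), so a point of `s_ε^ξ(K)` is the
root of a tree over `F ξ` whose `n`-th child lies in `s_ε^ζ(K)` (`exists_tree`). Errors `2⁻ⁿ` on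
dense sequences in `S` and in `X` make the tree `S`-null and the functionals weak* continuous. Read
as lists, the branches of such a tree survive `ξ` tree derivations (`mem_derivIter_normedTree`).

From vectors to functionals: a list in the `ξ`-th tree derivative is normed by a functional in the
`ξ`-th Szlenk derivative (`normingPart_nonempty_of_mem_derivIter`). Functionals norming the
extensions by `x i` have a weak* cluster point, which is small on `x i` for large `i` because it
lies in `K ⊆ S`, hence is far in norm from those functionals. The choice `S = K` needs `K` norm
separable; this holds whenever the Szlenk derivatives of `K` vanish by a fixed countable stage for
every `ε` (`isSeparable_of_not_condSzlenk`), which is what an argument by contradiction supplies.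

For the weak index, `S` is the dual ball, which may be nonseparable, and finite nets are too weak.
If `ℓ₁` does not embed, Rosenthal's theorem makes the almost norming vectors weakly Cauchy along a
subsequence, and halved differences are weakly null (`exists_weaklyNull_of_mem_szlenkDeriv`). -/

theorem derivIter_zero : derivIter d A 0 = A := by
  simp [derivIter]

theorem derivIter_add_one (ξ : Ordinal.{0}) :
    derivIter d A (ξ + 1) = d (derivIter d A ξ) := by
  simp only [derivIter, Ordinal.limitRecOn_add_one]

theorem derivIter_limit {ξ : Ordinal.{0}} (hξ : Order.IsSuccLimit ξ) :
    derivIter d A ξ = ⋂ (ζ : Ordinal.{0}) (_ : ζ < ξ), derivIter d A ζ := by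
  rw [derivIter, Ordinal.limitRecOn_limit _ _ _ _ hξ]
  rfl

variable {d A}

theorem derivIter_invariant {P : Set α → Prop} (hA : P A) (hd : ∀ B, P B → P (d B))
    (hI : ∀ (ξ : Ordinal.{0}) (s : Ordinal.{0} → Set α), (∀ ζ < ξ, P (s ζ)) →
      P (⋂ (ζ : Ordinal.{0}) (_ : ζ < ξ), s ζ)) (ξ : Ordinal.{0}) :
    P (derivIter d A ξ) := by
  induction ξ using Ordinal.limitRecOn with
  | zero => rwa [derivIter_zero]
  | add_one ξ ih => rw [derivIter_add_one]; exact hd _ ih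
  | limit ξ hξ ih => rw [derivIter_limit d A hξ]; exact hI ξ _ ih

/-- Contraction is asked only on the iterates, since the Szlenk derivation need not shrink a set
that is not weak* closed. -/
theorem derivIter_antitone (hd : ∀ ξ, d (derivIter d A ξ) ⊆ derivIter d A ξ)
    {ζ ξ : Ordinal.{0}} (h : ζ ≤ ξ) : derivIter d A ξ ⊆ derivIter d A ζ := by
  induction ξ using Ordinal.limitRecOn with
  | zero =>
    obtain rfl : ζ = 0 := by simpa using h
    exact subset_rfl
  | add_one ξ ih =>
    rcases h.lt_or_eq with h | rfl
    · rw [derivIter_add_one]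
      exact (hd ξ).trans (ih (Order.lt_add_one_iff.1 h))
    · exact subset_rfl
  | limit ξ hξ ih =>
    rcases h.lt_or_eq with h | rfl
    · rw [derivIter_limit d A hξ]
      exact iInter₂_subset ζ h
    · exact subset_rfl

theorem derivIndex_le : derivIndex d A ≤ ω₁ := csInf_le' (Or.inr rfl)

theorem derivIter_nonempty {ξ : Ordinal.{0}} (hξ : ξ < ω₁) (h : ξ < derivIndex d A) :
    (derivIter d A ξ).Nonempty := by
  by_contra hne
  have hmem : ξ ∈ ({ξ | ξ < ω₁ ∧ derivIter d A ξ = ∅} ∪ {ω₁} : Set Ordinal.{0}) :=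
    Or.inl ⟨hξ, not_nonempty_iff_eq_empty.1 hne⟩
  exact absurd (csInf_le' hmem) (not_le.2 h)

theorem lt_derivIndex (hd : ∀ ξ, d (derivIter d A ξ) ⊆ derivIter d A ξ) {ξ : Ordinal.{0}}
    (hξ : ξ < ω₁) (h : (derivIter d A ξ).Nonempty) : ξ < derivIndex d A := by
  by_contra hle
  rw [not_lt] at hle
  have hmem : derivIndex d A ∈ ({ξ | ξ < ω₁ ∧ derivIter d A ξ = ∅} ∪ {ω₁} : Set Ordinal.{0}) :=
    csInf_mem ⟨ω₁, Or.inr rfl⟩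
  rcases hmem with hmem | hmem
  · have := h.mono (derivIter_antitone hd hle)
    rw [hmem.2] at this
    exact not_nonempty_empty this
  · rw [mem_singleton_iff.1 hmem] at hle
    exact absurd hξ (not_lt.2 hle)

/-- An ordinal is determined by those strictly below it, and nothing from `ω₁` on lies below a term
of either family. Equality of suprema thus reduces to countable `ξ`, the form in which the
conditions are compared. -/
theorem iSup_eq_iSup_of_lt_iff {ι κ : Type} {a : ι → Ordinal.{0}} {b : κ → Ordinal.{0}}
    (ha : ∀ i, a i ≤ ω₁) (hb : ∀ i, b i ≤ ω₁)
    (h : ∀ ξ < ω₁, (∃ i, ξ < a i) ↔ ∃ i, ξ < b i) : ⨆ i, a i = ⨆ i, b i := by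
  refine eq_of_forall_lt_iff fun ξ => ?_
  rw [Ordinal.lt_iSup_iff, Ordinal.lt_iSup_iff]
  by_cases hξ : ξ < ω₁
  · exact h ξ hξ
  · constructor
    · rintro ⟨i, hi⟩
      exact absurd (hi.trans_le (ha i)) hξ
    · rintro ⟨i, hi⟩
      exact absurd (hi.trans_le (hb i)) hξ

theorem countable_Iio_of_lt_omega_one {ξ : Ordinal.{0}} (hξ : ξ < ω₁) : (Iio ξ).Countable := by
  rw [← Cardinal.le_aleph0_iff_set_countable, Cardinal.mk_Iio_ordinal, Cardinal.lift_le_aleph0]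
  have := (Cardinal.lt_ord (o := ξ) (c := Cardinal.aleph 1)).1 (by simpa using hξ)
  exact Cardinal.lt_aleph_one_iff.1 this

theorem seqDeriv_subset (σ : Set (ℕ → α)) (H : Set (List α)) : seqDeriv σ H ⊆ H :=
  fun _ h => h.1

theorem seqDeriv_mono {σ τ : Set (ℕ → α)} (h : σ ⊆ τ) {H G : Set (List α)} (hHG : H ⊆ G) :
    seqDeriv σ H ⊆ seqDeriv τ G :=
  fun _ ⟨ht, s, hs, hH⟩ => ⟨hHG ht, s, h hs, fun i => hHG (hH i)⟩

theorem derivIter_seqDeriv_mono {σ τ : Set (ℕ → α)} (h : σ ⊆ τ) (H : Set (List α))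
    (ξ : Ordinal.{0}) : derivIter (seqDeriv σ) H ξ ⊆ derivIter (seqDeriv τ) H ξ := by
  induction ξ using Ordinal.limitRecOn with
  | zero => rw [derivIter_zero, derivIter_zero]
  | add_one ξ ih =>
    rw [derivIter_add_one, derivIter_add_one]
    exact seqDeriv_mono h ih
  | limit ξ hξ ih =>
    rw [derivIter_limit _ _ hξ, derivIter_limit _ _ hξ]
    exact iInter₂_mono ih

theorem lt_seqIndex {σ : Set (ℕ → α)} {H : Set (List α)} {ξ : Ordinal.{0}} (hξ : ξ < ω₁)
    (h : (derivIter (seqDeriv σ) H ξ).Nonempty) : ξ < seqIndex σ H :=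
  lt_derivIndex (fun _ => seqDeriv_subset _ _) hξ h

end Derivations

/-! ### The Szlenk derivation -/

section SzlenkDerivation

variable {X : Type*} [NormedAddCommGroup X] [NormedSpace ℝ X]

/-- Weak* closedness of a set of functionals. -/
def IsWeakStarClosed (L : Set (StrongDual ℝ X)) : Prop :=
  IsClosed {g : WeakDual ℝ X | WeakDual.toStrongDual g ∈ L}

theorem IsWeakStarCompact.isWeakStarClosed {K : Set (StrongDual ℝ X)} (h : IsWeakStarCompact K) :
    IsWeakStarClosed K := by
  have : {g : WeakDual ℝ X | WeakDual.toStrongDual g ∈ K} =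
      (fun f : StrongDual ℝ X => StrongDual.toWeakDual f) '' K := by
    ext g
    exact ⟨fun hg => ⟨_, hg, rfl⟩, by rintro ⟨f, hf, rfl⟩; exact hf⟩
  rw [IsWeakStarClosed, this]
  exact h.isClosed

/-- An open set witnessing that one point is outside the derivative witnesses it for all its points;
`L` itself need not be closed. -/
theorem isWeakStarClosed_szlenkDeriv (ε : ℝ) (L : Set (StrongDual ℝ X)) :
    IsWeakStarClosed (szlenkDeriv ε L) := by
  rw [IsWeakStarClosed, ← isOpen_compl_iff, isOpen_iff_mem_nhds]
  intro g hg
  simp only [mem_compl_iff, mem_ofPred_eq, szlenkDeriv, not_forall] at hg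
  obtain ⟨V, hV, hd⟩ := hg
  obtain ⟨U, hUV, hU, hgU⟩ := mem_nhds_iff.1 hV
  refine mem_of_superset (hU.mem_nhds hgU) fun h hh hmem => ?_
  exact hd ((hmem U (hU.mem_nhds hh)).trans_le
    (Metric.ediam_mono fun k hk => ⟨hUV hk.1, hk.2⟩))

theorem szlenkDeriv_subset (ε : ℝ) {L : Set (StrongDual ℝ X)} (hL : IsWeakStarClosed L) :
    szlenkDeriv ε L ⊆ L := by
  intro f hf
  by_contra hfL
  have := hf {g : WeakDual ℝ X | WeakDual.toStrongDual g ∈ L}ᶜ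
    (hL.isOpen_compl.mem_nhds hfL)
  have he : {g : StrongDual ℝ X | StrongDual.toWeakDual g ∈
      {g : WeakDual ℝ X | WeakDual.toStrongDual g ∈ L}ᶜ ∧ g ∈ L} = ∅ := by
    ext g
    simp
  rw [he] at this
  simp at this

theorem isWeakStarClosed_derivIter {K : Set (StrongDual ℝ X)} (hK : IsWeakStarClosed K) (ε : ℝ)
    (ξ : Ordinal.{0}) : IsWeakStarClosed (derivIter (szlenkDeriv ε) K ξ) := by
  refine derivIter_invariant hK (fun B _ => isWeakStarClosed_szlenkDeriv ε B)
    (fun ξ s hs => ?_) ξ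
  have : {g : WeakDual ℝ X | WeakDual.toStrongDual g ∈
      ⋂ (ζ : Ordinal.{0}) (_ : ζ < ξ), s ζ} =
      ⋂ (ζ : Ordinal.{0}) (_ : ζ < ξ), {g : WeakDual ℝ X | WeakDual.toStrongDual g ∈ s ζ} := by
    ext g
    simp
  rw [IsWeakStarClosed, this]
  exact isClosed_biInter hs

theorem szlenkDeriv_derivIter_subset {K : Set (StrongDual ℝ X)} (hK : IsWeakStarClosed K) (ε : ℝ)
    (ξ : Ordinal.{0}) :
    szlenkDeriv ε (derivIter (szlenkDeriv ε) K ξ) ⊆ derivIter (szlenkDeriv ε) K ξ :=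
  szlenkDeriv_subset ε (isWeakStarClosed_derivIter hK ε ξ)

theorem derivIter_szlenkDeriv_antitone {K : Set (StrongDual ℝ X)} (hK : IsWeakStarClosed K)
    (ε : ℝ) {ζ ξ : Ordinal.{0}} (h : ζ ≤ ξ) :
    derivIter (szlenkDeriv ε) K ξ ⊆ derivIter (szlenkDeriv ε) K ζ :=
  derivIter_antitone (szlenkDeriv_derivIter_subset hK ε) h

theorem derivIter_szlenkDeriv_subset {K : Set (StrongDual ℝ X)} (hK : IsWeakStarClosed K)
    (ε : ℝ) (ξ : Ordinal.{0}) : derivIter (szlenkDeriv ε) K ξ ⊆ K := by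
  simpa [derivIter_zero] using derivIter_szlenkDeriv_antitone hK ε (zero_le (a := ξ))

theorem weakStar_ball_mem_nhds (f : StrongDual ℝ X) (T : Finset X) {η : ℝ} (hη : 0 < η) :
    {g : WeakDual ℝ X | ∀ v ∈ T, |g v - f v| < η} ∈ 𝓝 (StrongDual.toWeakDual f) := by
  have : {g : WeakDual ℝ X | ∀ v ∈ T, |g v - f v| < η} =
      ⋂ v ∈ T, {g : WeakDual ℝ X | |g v - f v| < η} := by
    ext g
    simp
  rw [this, biInter_finset_mem]
  intro v _
  refine (isOpen_lt ?_ continuous_const).mem_nhds (by simpa using hη)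
  exact ((WeakDual.eval_continuous v).sub continuous_const).abs

/-- A functional in the Szlenk derivative of `L` is approximated on finite sets by members of `L`
at norm distance more than `ε / 2`. -/
theorem exists_far_of_mem_szlenkDeriv {ε : ℝ} (hε : 0 < ε) {L : Set (StrongDual ℝ X)}
    {f : StrongDual ℝ X} (hf : f ∈ szlenkDeriv ε L) (T : Finset X) {η : ℝ} (hη : 0 < η) :
    ∃ h ∈ L, (∀ v ∈ T, |h v - f v| < η) ∧ ∃ u, ‖u‖ ≤ 1 ∧ ε / 2 < h u - f u := by
  by_contra hcon
  push Not at hcon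
  have hd := hf _ (weakStar_ball_mem_nhds f T hη)
  refine absurd hd (not_lt.2 ?_)
  -- Otherwise all nearby members of `L` lie within `ε / 2` of `f`, so their diameter is at most
  -- `ε`. Testing `u` and `-u` turns the one-sided bound into a norm bound.
  have key : ∀ h : StrongDual ℝ X, h ∈ L → (∀ v ∈ T, |h v - f v| < η) → ‖h - f‖ ≤ ε / 2 := by
    intro h hL hT
    refine ContinuousLinearMap.opNorm_le_of_unit_norm (by positivity) fun u hu => ?_
    have h1 := hcon h hL hT u hu.le
    have h2 := hcon h hL hT (-u) (by rw [norm_neg]; exact hu.le)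
    rw [Real.norm_eq_abs, sub_apply, abs_le]
    simp only [map_neg] at h2
    constructor <;> linarith
  refine Metric.ediam_le fun a ha b hb => ?_
  have h1 := key a ha.2 ha.1
  have h2 := key b hb.2 hb.1
  rw [edist_dist, dist_eq_norm]
  refine ENNReal.ofReal_le_ofReal ?_
  calc ‖a - b‖ = ‖(a - f) - (b - f)‖ := by congr 1; abel
    _ ≤ ‖a - f‖ + ‖b - f‖ := norm_sub_le _ _
    _ ≤ ε := by linarith

end SzlenkDerivation

/-! ### Initial segments and the decomposition of a finite set by its least element -/

theorem isPrefix_empty (E : Finset ℕ) : IsPrefix ∅ E := by simp [IsPrefix]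

theorem isPrefix_refl (E : Finset ℕ) : IsPrefix E E := by simp [IsPrefix]

theorem eq_empty_of_isPrefix_empty {G : Finset ℕ} (h : IsPrefix G ∅) : G = ∅ :=
  Finset.subset_empty.1 h.1

theorem IsPrefix.trans {F G E : Finset ℕ} (h : IsPrefix F G) (h' : IsPrefix G E) :
    IsPrefix F E := by
  refine ⟨h.1.trans h'.1, fun a ha b hb => ?_⟩
  rw [Finset.mem_sdiff] at hb
  by_cases hG : b ∈ G
  · exact h.2 a ha b (Finset.mem_sdiff.2 ⟨hG, hb.2⟩)
  · exact h'.2 a (h.1 ha) b (Finset.mem_sdiff.2 ⟨hb.1, hG⟩)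

theorem finset_empty_or_insert (E : Finset ℕ) :
    E = ∅ ∨ ∃ n B, (∀ k ∈ B, n < k) ∧ E = insert n B := by
  rcases E.eq_empty_or_nonempty with h | h
  · exact Or.inl h
  · refine Or.inr ⟨E.min' h, E.erase (E.min' h), fun k hk => ?_,
      (Finset.insert_erase (E.min'_mem h)).symm⟩
    exact E.min'_lt_of_mem_erase_min' h hk

theorem min'_insert_of_lt {n : ℕ} {B : Finset ℕ} (h : ∀ k ∈ B, n < k) :
    (insert n B).min' (Finset.insert_nonempty n B) = n := by
  refine le_antisymm (Finset.min'_le _ _ (Finset.mem_insert_self n B)) ?_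
  refine Finset.le_min' _ _ _ fun k hk => ?_
  rcases Finset.mem_insert.1 hk with rfl | hk
  · exact le_rfl
  · exact (h k hk).le

theorem erase_insert_of_lt {n : ℕ} {B : Finset ℕ} (h : ∀ k ∈ B, n < k) :
    (insert n B).erase n = B :=
  Finset.erase_insert fun hn => lt_irrefl _ (h n hn)

theorem isPrefix_insert_iff {n : ℕ} {G B : Finset ℕ} (hG : ∀ k ∈ G, n < k)
    (hB : ∀ k ∈ B, n < k) : IsPrefix (insert n G) (insert n B) ↔ IsPrefix G B := by
  constructor
  · rintro ⟨h1, h2⟩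
    refine ⟨fun k hk => ?_, fun a ha b hb => h2 a (Finset.mem_insert_of_mem ha) b ?_⟩
    · rcases Finset.mem_insert.1 (h1 (Finset.mem_insert_of_mem hk)) with rfl | h
      · exact absurd (hG k hk) (lt_irrefl _)
      · exact h
    · rw [Finset.mem_sdiff] at hb ⊢
      refine ⟨Finset.mem_insert_of_mem hb.1, fun h => ?_⟩
      rcases Finset.mem_insert.1 h with rfl | h
      · exact lt_irrefl _ (hB b hb.1)
      · exact hb.2 h
  · rintro ⟨h1, h2⟩
    refine ⟨Finset.insert_subset_insert n h1, fun a ha b hb => ?_⟩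
    rw [Finset.mem_sdiff, Finset.mem_insert, Finset.mem_insert, not_or] at hb
    have hbB : b ∈ B := hb.1.resolve_left hb.2.1
    rcases Finset.mem_insert.1 ha with rfl | ha
    · exact hB b hbB
    · exact h2 a ha b (Finset.mem_sdiff.2 ⟨hbB, hb.2.2⟩)

theorem exists_eq_insert_of_isPrefix_insert {n : ℕ} {G B : Finset ℕ} (hB : ∀ k ∈ B, n < k)
    (hG : G ≠ ∅) (h : IsPrefix G (insert n B)) :
    ∃ G', (∀ k ∈ G', n < k) ∧ G = insert n G' ∧ IsPrefix G' B := by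
  obtain ⟨a, ha⟩ := Finset.nonempty_iff_ne_empty.2 hG
  have hn : n ∈ G := by
    by_contra hn
    have h1 := h.2 a ha n (Finset.mem_sdiff.2 ⟨Finset.mem_insert_self n B, hn⟩)
    rcases Finset.mem_insert.1 (h.1 ha) with rfl | h2
    · exact hn ha
    · exact absurd (hB a h2) (by omega)
  have hlt : ∀ k ∈ G.erase n, n < k := by
    intro k hk
    rw [Finset.mem_erase] at hk
    exact hB k ((Finset.mem_insert.1 (h.1 hk.2)).resolve_left hk.1)
  have he : G = insert n (G.erase n) := (Finset.insert_erase hn).symm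
  refine ⟨G.erase n, hlt, he, ?_⟩
  rw [he] at h
  exact (isPrefix_insert_iff hlt hB).1 h

theorem exists_eq_insert_of_insert_isPrefix {n : ℕ} {G B : Finset ℕ} (hB : ∀ k ∈ B, n < k)
    (h : IsPrefix (insert n B) G) :
    ∃ G', (∀ k ∈ G', n < k) ∧ G = insert n G' ∧ IsPrefix B G' := by
  have hn : n ∈ G := h.1 (Finset.mem_insert_self n B)
  have hlt : ∀ k ∈ G.erase n, n < k := by
    intro k hk
    rw [Finset.mem_erase] at hk
    by_cases hkB : k ∈ B
    · exact hB k hkB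
    · exact h.2 n (Finset.mem_insert_self n B) k
        (Finset.mem_sdiff.2 ⟨hk.2, by simp [hk.1, hkB]⟩)
  have he : G = insert n (G.erase n) := (Finset.insert_erase hn).symm
  refine ⟨G.erase n, hlt, he, ?_⟩
  rw [he] at h
  exact (isPrefix_insert_iff hB hlt).1 h

theorem isPrefix_insert_of_lt {n : ℕ} {E : Finset ℕ} (hE : ∀ k ∈ E, k < n) :
    IsPrefix E (insert n E) := by
  refine ⟨Finset.subset_insert n E, fun a ha b hb => ?_⟩
  rw [Finset.mem_sdiff, Finset.mem_insert] at hb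
  rw [hb.1.resolve_right hb.2]
  exact hE a ha

/-- The function on finite sets with value `a` at `∅` and `b n B` at `{n} ∪ B`, `n < B`. -/
noncomputable def joinTree {α : Type*} (a : α) (b : ℕ → Finset ℕ → α) (E : Finset ℕ) : α :=
  open Classical in if h : E.Nonempty then b (E.min' h) (E.erase (E.min' h)) else a

theorem joinTree_empty {α : Type*} (a : α) (b : ℕ → Finset ℕ → α) : joinTree a b ∅ = a := by
  simp [joinTree]

theorem joinTree_insert {α : Type*} (a : α) (b : ℕ → Finset ℕ → α) {n : ℕ} {B : Finset ℕ}
    (h : ∀ k ∈ B, n < k) : joinTree a b (insert n B) = b n B := by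
  rw [joinTree, dif_pos (Finset.insert_nonempty n B), min'_insert_of_lt h, erase_insert_of_lt h]

/-! ### Structure of the fine Schreier families -/

namespace IsFineSchreier

variable {F : Ordinal.{0} → Set (Finset ℕ)}

theorem mem_add_one_iff {ξ : Ordinal.{0}} {n : ℕ} {B : Finset ℕ}
    (her : ∀ E ∈ F ξ, (∀ k ∈ E, 1 ≤ k) ∧ ∀ G ⊆ E, G ∈ F ξ) (hF : IsFineSchreier F) (hξ : ξ < ω₁)
    (hn : 1 ≤ n) (hB : ∀ k ∈ B, n < k) : insert n B ∈ F (ξ + 1) ↔ B ∈ F ξ := by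
  rw [hF.succ ξ hξ]
  constructor
  · rintro ⟨A, hA, C, hC, hAC, he⟩
    refine (her C hC).2 B fun k hk => ?_
    have hk' : k ∈ A ∪ C := he ▸ Finset.mem_insert_of_mem hk
    refine (Finset.mem_union.1 hk').resolve_left fun hkA => ?_
    have hn' : n ∈ A ∪ C := he ▸ Finset.mem_insert_self n B
    rcases Finset.mem_union.1 hn' with hnA | hnC
    · have := Finset.card_le_one.1 hA.1 k hkA n hnA
      exact absurd (hB k hk) (by omega)
    · exact absurd (hB k hk) (by have := hAC k hkA n hnC; omega)
  · intro hBF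
    refine ⟨{n}, ⟨by simp, by simpa using hn⟩, B, hBF, by simpa using hB, by simp⟩

theorem empty_mem_and_hereditary (hF : IsFineSchreier F) {ξ : Ordinal.{0}} (hξ : ξ < ω₁) :
    ∅ ∈ F ξ ∧ ∀ E ∈ F ξ, (∀ k ∈ E, 1 ≤ k) ∧ ∀ G ⊆ E, G ∈ F ξ := by
  induction ξ using Ordinal.limitRecOn with
  | zero => simp [hF.zero]
  | add_one ξ ih =>
    have hξ' : ξ < ω₁ := lt_of_le_of_lt le_self_add hξ
    obtain ⟨i1, i2⟩ := ih hξ'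
    rw [hF.succ ξ hξ']
    refine ⟨⟨∅, by simp [cardFamily], ∅, i1, by simp, by simp⟩, ?_⟩
    rintro E ⟨A, hA, B, hB, hAB, rfl⟩
    refine ⟨fun k hk => (Finset.mem_union.1 hk).elim (hA.2 k) ((i2 B hB).1 k), fun G hG => ?_⟩
    refine ⟨A ∩ G, ⟨(Finset.card_le_card Finset.inter_subset_left).trans hA.1,
      fun k hk => hA.2 k (Finset.mem_inter.1 hk).1⟩, B ∩ G,
      (i2 B hB).2 _ Finset.inter_subset_left, ?_, ?_⟩
    · intro a ha b hb
      exact hAB a (Finset.mem_inter.1 ha).1 b (Finset.mem_inter.1 hb).1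
    · rw [← Finset.union_inter_distrib_right, Finset.inter_eq_right.2 hG]
  | limit ξ hlim ih =>
    obtain ⟨s, -, hs, -, -, he⟩ := hF.limit ξ hξ hlim
    rw [he]
    refine ⟨⟨1, le_rfl, by simp, (ih _ (hs 1) ((hs 1).trans hξ)).1⟩, ?_⟩
    rintro E ⟨n, hn, hk, hE⟩
    have h1 := (ih _ (hs n) ((hs n).trans hξ)).2 E hE
    exact ⟨h1.1, fun G hG => ⟨n, hn, fun k hk' => hk k (hG hk'), h1.2 G hG⟩⟩

theorem empty_mem (hF : IsFineSchreier F) {ξ : Ordinal.{0}} (hξ : ξ < ω₁) : ∅ ∈ F ξ :=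
  (hF.empty_mem_and_hereditary hξ).1

theorem one_le (hF : IsFineSchreier F) {ξ : Ordinal.{0}} (hξ : ξ < ω₁) {E : Finset ℕ}
    (hE : E ∈ F ξ) {k : ℕ} (hk : k ∈ E) : 1 ≤ k :=
  ((hF.empty_mem_and_hereditary hξ).2 E hE).1 k hk

theorem mem_of_subset (hF : IsFineSchreier F) {ξ : Ordinal.{0}} (hξ : ξ < ω₁) {E G : Finset ℕ}
    (hE : E ∈ F ξ) (hG : G ⊆ E) : G ∈ F ξ :=
  ((hF.empty_mem_and_hereditary hξ).2 E hE).2 G hG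

theorem insert_mem_add_one_iff (hF : IsFineSchreier F) {ξ : Ordinal.{0}} (hξ : ξ < ω₁) {n : ℕ}
    {B : Finset ℕ} (hn : 1 ≤ n) (hB : ∀ k ∈ B, n < k) : insert n B ∈ F (ξ + 1) ↔ B ∈ F ξ :=
  mem_add_one_iff (hF.empty_mem_and_hereditary hξ).2 hF hξ hn hB

theorem subset_add_one (hF : IsFineSchreier F) {ξ : Ordinal.{0}} (hξ : ξ < ω₁) :
    F ξ ⊆ F (ξ + 1) := by
  intro E hE
  rw [hF.succ ξ hξ]
  exact ⟨∅, by simp [cardFamily], E, hE, by simp, by simp⟩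

/-- The sets in `F ξ` with least element `n` are either absent, or obtained from those members of
an earlier family that lie above `n`. -/
theorem section_eq (hF : IsFineSchreier F) {ξ : Ordinal.{0}} (hξ : ξ < ω₁) (n : ℕ) :
    (∀ B : Finset ℕ, (∀ k ∈ B, n < k) → insert n B ∉ F ξ) ∨
      ∃ ζ < ξ, ∀ B : Finset ℕ, (∀ k ∈ B, n < k) → (insert n B ∈ F ξ ↔ B ∈ F ζ) := by
  rcases Nat.eq_zero_or_pos n with rfl | hn
  · left
    intro B _ h
    exact absurd (hF.one_le hξ h (Finset.mem_insert_self 0 B)) (by omega)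
  induction ξ using Ordinal.limitRecOn with
  | zero =>
    left
    intro B _ h
    rw [hF.zero, mem_singleton_iff] at h
    exact Finset.insert_ne_empty n B h
  | add_one ξ ih =>
    exact Or.inr ⟨ξ, by simp, fun B hB =>
      hF.insert_mem_add_one_iff (lt_of_le_of_lt le_self_add hξ) hn hB⟩
  | limit ξ hlim ih =>
    obtain ⟨s, -, hs, -, hsub, he⟩ := hF.limit ξ hξ hlim
    have hmono : Monotone fun k => F (s k) := monotone_nat_of_le_succ hsub
    -- A set with least element `n` enters the diagonal family only through some `F (s k)` with `k ≤
    -- n`, and these increase with `k`, so `k = n` decides.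
    have key : ∀ B : Finset ℕ, (∀ k ∈ B, n < k) →
        (insert n B ∈ F ξ ↔ insert n B ∈ F (s n)) := by
      intro B hB
      rw [he]
      constructor
      · rintro ⟨k, -, hk, hB'⟩
        exact hmono (hk n (Finset.mem_insert_self n B)) hB'
      · intro h
        refine ⟨n, hn, fun k hk => ?_, h⟩
        rcases Finset.mem_insert.1 hk with rfl | hk
        · exact le_rfl
        · exact (hB k hk).le
    rcases ih (s n) (hs n) ((hs n).trans hξ) with h | ⟨ζ, hζ, h⟩
    · exact Or.inl fun B hB h' => h B hB ((key B hB).1 h')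
    · exact Or.inr ⟨ζ, hζ.trans (hs n), fun B hB => (key B hB).trans (h B hB)⟩

/-- Induction over sections. Nonempty sets are the right form: an extension of `insert k C` in the
earlier family keeps its least element `k > n`, so it stays in the region where the section
describes `F ξ`; an extension of `∅` might not. -/
theorem exists_maxMember_of_insert (hF : IsFineSchreier F) {ξ : Ordinal.{0}} (hξ : ξ < ω₁)
    {n : ℕ} {B : Finset ℕ} (hB : ∀ k ∈ B, n < k) (hE : insert n B ∈ F ξ) :
    ∃ M ∈ maxMembers (F ξ), IsPrefix (insert n B) M := by
  induction ξ using WellFoundedLT.induction generalizing n B with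
  | ind ξ ih =>
  rcases hF.section_eq hξ n with h | ⟨ζ, hζ, h⟩
  · exact absurd hE (h B hB)
  have hζ' := hζ.trans hξ
  have lift : ∀ k C, n < k → (∀ j ∈ C, k < j) → insert k C ∈ F ζ →
      ∃ M ∈ maxMembers (F ξ), IsPrefix (insert n (insert k C)) M := by
    intro k C hnk hC hCF
    obtain ⟨M, hM, hCM⟩ := ih ζ hζ hζ' hC hCF
    obtain ⟨M', hM'k, rfl, -⟩ := exists_eq_insert_of_insert_isPrefix hC hCM
    have hlt : ∀ j ∈ insert k M', n < j := by
      intro j hj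
      rcases Finset.mem_insert.1 hj with rfl | hj
      · exact hnk
      · exact hnk.trans (hM'k j hj)
    have hlt' : ∀ j ∈ insert k C, n < j := by
      intro j hj
      rcases Finset.mem_insert.1 hj with rfl | hj
      · exact hnk
      · exact hnk.trans (hC j hj)
    refine ⟨insert n (insert k M'), ⟨(h _ hlt).2 hM.1, fun G hG hp => ?_⟩,
      (isPrefix_insert_iff hlt' hlt).2 hCM⟩
    obtain ⟨G', hG', rfl, hp'⟩ := exists_eq_insert_of_insert_isPrefix hlt hp
    rw [hM.2 G' ((h _ hG').1 hG) hp']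
  rcases finset_empty_or_insert B with rfl | ⟨k, C, hC, rfl⟩
  · by_cases hk : ∃ k, n < k ∧ insert k ∅ ∈ F ζ
    · obtain ⟨k, hnk, hk⟩ := hk
      obtain ⟨M, hM, hp⟩ := lift k ∅ hnk (by simp) hk
      exact ⟨M, hM, ((isPrefix_insert_iff (by simp) (by simpa using hnk)).2
        (isPrefix_empty _)).trans hp⟩
    · refine ⟨_, ⟨hE, fun G hG hp => ?_⟩, isPrefix_refl _⟩
      obtain ⟨G', hG', rfl, -⟩ := exists_eq_insert_of_insert_isPrefix hB hp
      rcases finset_empty_or_insert G' with rfl | ⟨k, C, hC, rfl⟩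
      · rfl
      · refine absurd ⟨k, hG' k (Finset.mem_insert_self k C), ?_⟩ hk
        exact hF.mem_of_subset hζ' ((h _ hG').1 hG) (by simp)
  · exact lift k C (hB k (Finset.mem_insert_self k C)) hC ((h _ hB).1 hE)

theorem exists_maxMember (hF : IsFineSchreier F) {ξ : Ordinal.{0}} (hξ : ξ < ω₁)
    {E : Finset ℕ} (hE : E ∈ F ξ) : ∃ M ∈ maxMembers (F ξ), IsPrefix E M := by
  rcases finset_empty_or_insert E with rfl | ⟨n, B, hB, rfl⟩
  · by_cases h : ∃ G ∈ F ξ, G ≠ ∅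
    · obtain ⟨G, hG, hne⟩ := h
      rcases finset_empty_or_insert G with rfl | ⟨n, B, hB, rfl⟩
      · exact absurd rfl hne
      · obtain ⟨M, hM, -⟩ := hF.exists_maxMember_of_insert hξ hB hG
        exact ⟨M, hM, isPrefix_empty M⟩
    · push Not at h
      exact ⟨∅, ⟨hE, fun G hG _ => h G hG⟩, isPrefix_refl ∅⟩
  · exact hF.exists_maxMember_of_insert hξ hB hE

end IsFineSchreier

/-! ### Trees in the Szlenk derivatives -/

section Trees

variable {X : Type*} [NormedAddCommGroup X] [NormedSpace ℝ X]

/-- The unit ball has finite nets with respect to finitely many functionals. -/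
theorem exists_finite_net (Γ : Finset (StrongDual ℝ X)) {η : ℝ} (hη : 0 < η) :
    ∃ N : Finset X, (∀ w ∈ N, ‖w‖ ≤ 1) ∧
      ∀ u : X, ‖u‖ ≤ 1 → ∃ w ∈ N, ∀ g ∈ Γ, |g u - g w| < η := by
  -- The ball has bounded, hence totally bounded, image in a finite dimensional space; the net is
  -- taken inside that image.
  let Φ : X → (Γ → ℝ) := fun u g => g.1 u
  have hb : Bornology.IsBounded (Φ '' {u | ‖u‖ ≤ 1}) := by
    rw [isBounded_iff_forall_norm_le]
    refine ⟨∑ g : Γ, ‖g.1‖, ?_⟩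
    rintro _ ⟨u, hu, rfl⟩
    refine (pi_norm_le_iff_of_nonneg (by positivity)).2 fun g => ?_
    calc ‖g.1 u‖ ≤ ‖g.1‖ * ‖u‖ := g.1.le_opNorm u
      _ ≤ ‖g.1‖ * 1 := by gcongr; exact hu
      _ ≤ ∑ g : Γ, ‖g.1‖ := by
        rw [mul_one]
        exact Finset.single_le_sum (f := fun g : Γ => ‖g.1‖) (fun _ _ => norm_nonneg _)
          (Finset.mem_univ g)
  obtain ⟨t, hts, htf, hcov⟩ :=
    Metric.finite_approx_of_totallyBounded
      (hb.isCompact_closure.totallyBounded.subset subset_closure) η hη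
  obtain ⟨t, rfl⟩ := htf.exists_finset_coe
  obtain ⟨N, hN, rfl⟩ := Finset.subset_set_image_iff.1 hts
  refine ⟨N, fun w hw => hN hw, fun u hu => ?_⟩
  obtain ⟨z, hz, hd⟩ := mem_iUnion₂.1 (hcov ⟨u, hu, rfl⟩)
  obtain ⟨w, hw, rfl⟩ := Finset.mem_image.1 hz
  refine ⟨w, hw, fun g hg => ?_⟩
  rw [Metric.mem_ball, dist_pi_lt_iff hη] at hd
  simpa [Real.dist_eq] using hd ⟨g, hg⟩

/-- The net is fixed before `h`, so `h` can be required to be close to `f` on it. If `w` in the net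
imitates the almost norming vector `u` on `Γ` and on `f`, then `x = (u - w) / 2`. -/
theorem exists_near_of_mem_szlenkDeriv {ε : ℝ} (hε : 0 < ε) {L : Set (StrongDual ℝ X)}
    {f : StrongDual ℝ X} (hf : f ∈ szlenkDeriv ε L) (T : Finset X)
    (Γ : Finset (StrongDual ℝ X)) {η : ℝ} (hη : 0 < η) :
    ∃ h ∈ L, (∀ v ∈ T, |h v - f v| < η) ∧
      ∃ x, ‖x‖ ≤ 1 ∧ (∀ g ∈ Γ, |g x| < η) ∧ ε / 5 < h x := by
  classical
  -- Two errors of `ε / 30` leave `(ε / 2 - ε / 15) / 2 = 13 ε / 60`, which exceeds `ε / 5`.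
  have hη' : 0 < min η (ε / 30) := lt_min hη (by positivity)
  obtain ⟨N, hN, hnet⟩ := exists_finite_net (insert f Γ) hη'
  obtain ⟨h, hL, hT, u, hu, hlt⟩ := exists_far_of_mem_szlenkDeriv hε hf (T ∪ N) hη'
  obtain ⟨w, hw, hwΓ⟩ := hnet u hu
  have hmid : ∀ g : StrongDual ℝ X, g ((2 : ℝ)⁻¹ • (u - w)) = (g u - g w) / 2 := by
    intro g
    rw [map_smul, map_sub, _root_.smul_eq_mul]
    ring
  refine ⟨h, hL, fun v hv => (hT v (Finset.mem_union_left N hv)).trans_le (min_le_left _ _),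
    (2 : ℝ)⁻¹ • (u - w), ?_, fun g hg => ?_, ?_⟩
  · rw [norm_smul, Real.norm_of_nonneg (by norm_num)]
    have := norm_sub_le u w
    have := hN w hw
    linarith
  · have := (hwΓ g (Finset.mem_insert_of_mem hg)).trans_le (min_le_left _ _)
    rw [hmid, abs_div, abs_of_pos (zero_lt_two (α := ℝ))]
    linarith
  · have h1 := (hT w (Finset.mem_union_right T hw)).trans_le (min_le_right _ _)
    have h2 := (hwΓ f (Finset.mem_insert_self f Γ)).trans_le (min_le_right _ _)
    rw [abs_lt] at h1 h2
    rw [hmid]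
    linarith [h1.1, h1.2, h2.1, h2.2]

theorem exists_pos_forall_lt {α : Type*} (t : Finset α) (f : α → ℝ) {c : ℝ} (h : ∀ w ∈ t, c < f w) :
    ∃ η > 0, ∀ w ∈ t, η < f w - c := by
  have h1 : ∀ᶠ η in 𝓝[>] (0 : ℝ), ∀ w ∈ t, η < f w - c :=
    (eventually_all_finset t).2 fun w hw =>
      eventually_nhdsWithin_of_eventually_nhds (eventually_lt_nhds (by linarith [h w hw]))
  obtain ⟨η, hη, hpos⟩ := (h1.and self_mem_nhdsWithin).exists
  exact ⟨η, hpos, hη⟩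

/-- The finite set `t` carries the vectors already chosen on the branch: the strict inequalities on
it are open conditions, so they pass to nearby functionals and down the recursion. The bounds along
`g` will give nullity, those along `v` weak* continuity. -/
theorem exists_tree {F : Ordinal.{0} → Set (Finset ℕ)} (hF : IsFineSchreier F)
    {K : Set (StrongDual ℝ X)} (hK : IsWeakStarClosed K) {ε : ℝ} (hε : 0 < ε)
    (g : ℕ → StrongDual ℝ X) (v : ℕ → X) {ξ : Ordinal.{0}} (hξ : ξ < ω₁)
    {f : StrongDual ℝ X} (hf : f ∈ derivIter (szlenkDeriv ε) K ξ) (t : Finset X)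
    (ht : ∀ w ∈ t, ε / 5 < f w) :
    ∃ (x : Finset ℕ → X) (y : Finset ℕ → StrongDual ℝ X), y ∅ = f ∧ (∀ E, ‖x E‖ ≤ 1) ∧
      (∀ E, y E ∈ K) ∧
      (∀ E n, (∀ k ∈ E, k < n) → ∀ i ≤ n, |g i (x (insert n E))| ≤ (1 / 2) ^ n) ∧
      (∀ E G p, IsPrefix G E → (∀ k ∈ E \ G, p < k) →
        ∀ i ≤ p, |y E (v i) - y G (v i)| ≤ (1 / 2) ^ p) ∧
      (∀ E, ∀ w ∈ t, ε / 5 < y E w) ∧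
      ∀ E ∈ F ξ, ∀ G, IsPrefix G E → G ≠ ∅ → ε / 5 < y E (x G) := by
  classical
  induction ξ using WellFoundedLT.induction generalizing f t with
  | ind ξ ih =>
  have hfK : f ∈ K := derivIter_szlenkDeriv_subset hK ε ξ hf
  have node : ∀ n : ℕ, ∃ (x₀ : X) (x : Finset ℕ → X) (y : Finset ℕ → StrongDual ℝ X),
      ‖x₀‖ ≤ 1 ∧ (∀ E, ‖x E‖ ≤ 1) ∧ (∀ E, y E ∈ K) ∧ (∀ i ≤ n, |g i x₀| ≤ (1 / 2) ^ n) ∧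
      (∀ E m, (∀ k ∈ E, k < m) → ∀ i ≤ m, |g i (x (insert m E))| ≤ (1 / 2) ^ m) ∧
      (∀ i ≤ n, |y ∅ (v i) - f (v i)| ≤ (1 / 2) ^ n) ∧
      (∀ E G p, IsPrefix G E → (∀ k ∈ E \ G, p < k) →
        ∀ i ≤ p, |y E (v i) - y G (v i)| ≤ (1 / 2) ^ p) ∧
      (∀ E, ∀ w ∈ t, ε / 5 < y E w) ∧
      (∀ B, (∀ k ∈ B, n < k) → insert n B ∈ F ξ → ε / 5 < y B x₀ ∧
        ∀ G, IsPrefix G B → G ≠ ∅ → ε / 5 < y B (x G)) := by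
    intro n
    rcases hF.section_eq hξ n with hn | ⟨ζ, hζ, hn⟩
    -- No member of `F ξ` starts with `n`; the zero vectors and the constant family `f` satisfy
    -- every remaining requirement.
    · refine ⟨0, fun _ => 0, fun _ => f, by simp, by simp, fun _ => hfK, by simp, by simp,
        by simp, by simp, fun _ => ht, fun B hB h => absurd h (hn B hB)⟩
    -- Since `ζ + 1 ≤ ξ`, `f` survives one more derivation than stage `ζ`; this supplies the child
    -- `h` in stage `ζ`.
    · have hf' : f ∈ szlenkDeriv ε (derivIter (szlenkDeriv ε) K ζ) := by
        rw [← derivIter_add_one (szlenkDeriv ε) K ζ]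
        exact derivIter_szlenkDeriv_antitone hK ε (Order.add_one_le_of_lt hζ) hf
      obtain ⟨η, hη, htη⟩ := exists_pos_forall_lt t f ht
      obtain ⟨h, hL, hT, x₀, hx₀, hΓ, hlt⟩ := exists_near_of_mem_szlenkDeriv hε hf'
        (t ∪ (Finset.range (n + 1)).image v) ((Finset.range (n + 1)).image g)
        (lt_min hη (pow_pos (one_half_pos (α := ℝ)) n))
      have htw : ∀ w ∈ insert x₀ t, ε / 5 < h w := by
        intro w hw
        rcases Finset.mem_insert.1 hw with rfl | hw
        · exact hlt
        · have h1 := (hT w (Finset.mem_union_left _ hw)).trans_le (min_le_left _ _)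
          have h2 := htη w hw
          rw [abs_lt] at h1
          linarith [h1.1]
      obtain ⟨x, y, hy0, hx, hy, hg, hv, hyt, hyx⟩ := ih ζ hζ (hζ.trans hξ) hL _ htw
      refine ⟨x₀, x, y, hx₀, hx, hy, fun i hi => ?_, hg, fun i hi => ?_, hv,
        fun E w hw => hyt E w (Finset.mem_insert_of_mem hw),
        fun B hB hBF => ⟨hyt B x₀ (Finset.mem_insert_self _ _), hyx B ((hn B hB).1 hBF)⟩⟩
      · exact ((hΓ (g i) (Finset.mem_image_of_mem g (by simp; omega))).trans_le
          (min_le_right _ _)).le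
      · rw [hy0]
        exact ((hT (v i) (Finset.mem_union_right _
          (Finset.mem_image_of_mem v (by simp; omega)))).trans_le (min_le_right _ _)).le
  choose x₀ x y hx₀ hx hy hg₀ hg hv₀ hv hyt hyx using node
  -- The recursive tree below `n` prescribes nothing useful at `∅`; that place is the node `{n}` and
  -- receives the new vector `x₀ n`.
  refine ⟨joinTree 0 fun n => joinTree (x₀ n) fun k B => x n (insert k B),
    joinTree f y, joinTree_empty _ _, fun E => ?_, fun E => ?_, fun E n hE i hi => ?_,
    fun E G p hGE hp i hi => ?_, fun E w hw => ?_, fun E hE G hGE hG => ?_⟩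
  · rcases finset_empty_or_insert E with rfl | ⟨n, B, hB, rfl⟩
    · simp [joinTree_empty]
    · rw [joinTree_insert _ _ hB]
      rcases finset_empty_or_insert B with rfl | ⟨k, C, hC, rfl⟩
      · rw [joinTree_empty]
        exact hx₀ n
      · rw [joinTree_insert _ _ hC]
        exact hx n _
  · rcases finset_empty_or_insert E with rfl | ⟨n, B, hB, rfl⟩
    · rwa [joinTree_empty]
    · rw [joinTree_insert _ _ hB]
      exact hy n B
  · rcases finset_empty_or_insert E with rfl | ⟨m, B, hB, rfl⟩
    · rw [joinTree_insert _ _ (by simp), joinTree_empty]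
      exact hg₀ n i hi
    · have hmn : m < n := hE m (Finset.mem_insert_self m B)
      have hB' : ∀ k ∈ insert n B, m < k := by
        intro k hk
        rcases Finset.mem_insert.1 hk with rfl | hk
        · exact hmn
        · exact hB k hk
      rw [Finset.insert_comm, joinTree_insert _ _ hB']
      have hBn : ∀ k ∈ B, k < n := fun k hk => hE k (Finset.mem_insert_of_mem hk)
      have he : joinTree (x₀ m) (fun k B => x m (insert k B)) (insert n B) =
          x m (insert n B) := by
        rcases finset_empty_or_insert (insert n B) with h | ⟨k, C, hC, h⟩
        · exact absurd h (Finset.insert_ne_empty n B)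
        · rw [h, joinTree_insert _ _ hC]
      rw [he]
      exact hg m B n hBn i hi
  · rcases finset_empty_or_insert E with rfl | ⟨n, B, hB, rfl⟩
    · rw [eq_empty_of_isPrefix_empty hGE]
      simp
    · rw [joinTree_insert _ _ hB]
      rcases eq_or_ne G ∅ with rfl | hG
      · rw [joinTree_empty]
        have hpn : p < n := hp n (by simp)
        have h1 := hv n B ∅ n (isPrefix_empty B) (by simpa using hB) i (by omega)
        have h2 := hv₀ n i (by omega)
        have h3 := abs_sub_le (y n B (v i)) (y n ∅ (v i)) (f (v i))
        -- Passing from the root to `{n}` and then on to `E` costs `2⁻ⁿ` twice, and `2 · 2⁻ⁿ ≤ 2⁻ᵖ`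
        -- because `p < n`.
        have h4 : ((1 : ℝ) / 2) ^ n ≤ (1 / 2) ^ (p + 1) :=
          pow_le_pow_of_le_one (by norm_num) (by norm_num) hpn
        rw [pow_succ] at h4
        linarith
      · obtain ⟨G', hG', rfl, hp'⟩ := exists_eq_insert_of_isPrefix_insert hB hG hGE
        rw [joinTree_insert _ _ hG']
        refine hv n B G' p hp' (fun k hk => hp k ?_) i hi
        rw [Finset.mem_sdiff] at hk ⊢
        refine ⟨Finset.mem_insert_of_mem hk.1, fun h => ?_⟩
        rcases Finset.mem_insert.1 h with rfl | h
        · exact lt_irrefl _ (hB k hk.1)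
        · exact hk.2 h
  · rcases finset_empty_or_insert E with rfl | ⟨n, B, hB, rfl⟩
    · rw [joinTree_empty]
      exact ht w hw
    · rw [joinTree_insert _ _ hB]
      exact hyt n B w hw
  · rcases finset_empty_or_insert E with rfl | ⟨n, B, hB, rfl⟩
    · exact absurd (eq_empty_of_isPrefix_empty hGE) hG
    · obtain ⟨G', hG', rfl, hp'⟩ := exists_eq_insert_of_isPrefix_insert hB hG hGE
      rw [joinTree_insert _ _ hB, joinTree_insert _ _ hG']
      rcases finset_empty_or_insert G' with rfl | ⟨k, C, hC, rfl⟩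
      · rw [joinTree_empty]
        exact (hyx n B hB hE).1
      · rw [joinTree_insert _ _ hC]
        exact (hyx n B hB hE).2 _ hp' (Finset.insert_ne_empty k C)

/-! ### Weak* continuity and null trees from the Szlenk derivatives -/

theorem cantorTopology_eventually (E : Finset ℕ) (p : ℕ) :
    ∀ᶠ E' in @nhds _ cantorTopology E, ∀ k ≤ p, (k ∈ E' ↔ k ∈ E) := by
  rw [cantorTopology, nhds_induced]
  have : {h : ℕ → Bool | ∀ k ∈ Iic p, h k ∈ ({decide (k ∈ E)} : Set Bool)} ∈
      𝓝 (fun k => decide (k ∈ E)) :=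
    set_pi_mem_nhds (finite_Iic p) fun k _ => (isOpen_discrete _).mem_nhds rfl
  refine mem_of_superset (preimage_mem_comap this) fun E' hE' k hk => ?_
  have := hE' k hk
  simpa using this

theorem isWeakStarContinuous_of_forall {Fam : Set (Finset ℕ)} {y : Finset ℕ → StrongDual ℝ X}
    (h : ∀ E ∈ Fam, ∀ u : X, ∀ δ > 0, ∀ᶠ E' in @nhds _ cantorTopology E, |y E' u - y E u| < δ) :
    IsWeakStarContinuous Fam y := by
  intro E hE
  refine tendsto_iff_forall_eval_tendsto_topDualPairing.2 fun u => ?_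
  rw [Metric.tendsto_nhds]
  intro δ hδ
  refine Filter.Eventually.filter_mono (@nhdsWithin_le_nhds _ cantorTopology E Fam) ?_
  exact h E hE u δ hδ

theorem exists_seq_of_isSeparable {Y : Type*} [PseudoMetricSpace Y] {S : Set Y}
    (hS : S.Nonempty) (h : TopologicalSpace.IsSeparable S) :
    ∃ g : ℕ → Y, ∀ f ∈ S, ∀ δ > 0, ∃ i, dist f (g i) < δ := by
  obtain ⟨c, hc, hSc⟩ := h
  have hne : c.Nonempty := by
    obtain ⟨f, hf⟩ := hS
    exact closure_nonempty_iff.1 ⟨f, hSc hf⟩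
  obtain ⟨g, rfl⟩ := hc.exists_eq_range hne
  refine ⟨g, fun f hf δ hδ => ?_⟩
  obtain ⟨_, ⟨i, rfl⟩, hi⟩ := Metric.mem_closure_iff.1 (hSc hf) δ hδ
  exact ⟨i, hi⟩

theorem abs_apply_le_of_norm_le_one (f : StrongDual ℝ X) {x : X} (hx : ‖x‖ ≤ 1) :
    |f x| ≤ ‖f‖ := by
  have := f.le_opNorm_of_le hx
  rwa [mul_one, Real.norm_eq_abs] at this

theorem condTreeCont_of_condSzlenk [TopologicalSpace.SeparableSpace X]
    {F : Ordinal.{0} → Set (Finset ℕ)} (hF : IsFineSchreier F)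
    {K : Set (StrongDual ℝ X)} (hball : ∀ f ∈ K, ‖f‖ ≤ 1) (hK : IsWeakStarClosed K)
    {ξ : Ordinal.{0}} (hξ : ξ < ω₁) (h : condSzlenk K ξ) : condTreeCont K (F ξ) := by
  obtain ⟨ε, hε, h⟩ := h
  obtain ⟨f, hf⟩ := derivIter_nonempty hξ h
  refine ⟨ε / 5, by positivity, fun S hS hsep => ?_⟩
  obtain ⟨g, hg⟩ := exists_seq_of_isSeparable hS hsep
  obtain ⟨v, hv⟩ := exists_seq_of_isSeparable (univ_nonempty (α := X))
    (TopologicalSpace.IsSeparable.of_separableSpace univ)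
  obtain ⟨x, y, -, hx, hy, hgx, hvy, -, hyx⟩ := exists_tree hF hK hε g v hξ hf ∅ (by simp)
  refine ⟨x, y, ⟨fun E _ _ => hx E, fun E _ f hf => ?_⟩, fun E _ => hy E,
    isWeakStarContinuous_of_forall fun E hE u δ hδ => ?_,
    fun E hE G hG hne => (hyx E hE G hG hne).le⟩
  · rw [Metric.tendsto_atTop]
    intro δ hδ
    obtain ⟨i, hi⟩ := hg f hf (δ / 2) (half_pos hδ)
    obtain ⟨N, hN⟩ := exists_pow_lt_of_lt_one (half_pos hδ) (one_half_lt_one (α := ℝ))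
    refine ⟨max (max i N) (E.sup id + 1), fun n hn => ?_⟩
    have hEn : ∀ k ∈ E, k < n := by
      intro k hk
      have : k ≤ E.sup id := Finset.le_sup (f := id) hk
      have := (le_max_right _ _).trans hn
      omega
    have hin : i ≤ n := (le_max_left i N).trans ((le_max_left _ _).trans hn)
    have hNn : N ≤ n := (le_max_right i N).trans ((le_max_left _ _).trans hn)
    have h1 := hgx E n hEn i hin
    have h2 := abs_apply_le_of_norm_le_one (f - g i) (hx (insert n E))
    have h3 : ((1 : ℝ) / 2) ^ n ≤ (1 / 2) ^ N :=
      pow_le_pow_of_le_one (by norm_num) (by norm_num) hNn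
    rw [dist_eq_norm] at hi
    rw [sub_apply] at h2
    rw [Real.dist_eq, _root_.sub_zero]
    have h4 := abs_add_le (f (x (insert n E)) - g i (x (insert n E))) (g i (x (insert n E)))
    rw [sub_add_cancel] at h4
    linarith
  · obtain ⟨i, hi⟩ := hv u (mem_univ u) (δ / 3) (by positivity)
    obtain ⟨N, hN⟩ := exists_pow_lt_of_lt_one (show 0 < δ / 3 by positivity)
      (one_half_lt_one (α := ℝ))
    have hEp : ∀ k ∈ E, k ≤ max (max i N) (E.sup id) := fun k hk =>
      (Finset.le_sup (f := id) hk).trans (le_max_right _ _)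
    -- A set agreeing with `E` up to a bound `p ≥ max E` has `E` as an initial segment, and its
    -- further elements exceed `p`. The estimate along `v` then applies, and the unit ball bound
    -- transfers it to `u`.
    filter_upwards [cantorTopology_eventually E (max (max i N) (E.sup id))] with E' hE'
    have hp : ∀ k ∈ E' \ E, max (max i N) (E.sup id) < k := by
      intro k hk
      rw [Finset.mem_sdiff] at hk
      by_contra hle
      exact hk.2 ((hE' k (not_lt.1 hle)).1 hk.1)
    have hpre : IsPrefix E E' :=
      ⟨fun k hk => (hE' k (hEp k hk)).2 hk, fun a ha b hb => (hEp a ha).trans_lt (hp b hb)⟩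
    have h1 := hvy E' E _ hpre hp i ((le_max_left i N).trans (le_max_left _ _))
    have h2 : ((1 : ℝ) / 2) ^ (max (max i N) (E.sup id)) ≤ (1 / 2) ^ N :=
      pow_le_pow_of_le_one (by norm_num) (by norm_num)
        ((le_max_right i N).trans (le_max_left _ _))
    have h3 : ∀ G, |y G u - y G (v i)| < δ / 3 := by
      intro G
      have h := (y G).le_of_opNorm_le (hball _ (hy G)) (u - v i)
      rw [one_mul, map_sub, Real.norm_eq_abs, ← dist_eq_norm] at h
      exact h.trans_lt hi
    have h4 := h3 E'
    have h5 := h3 E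
    rw [abs_lt] at h4 h5 ⊢
    rw [abs_le] at h1
    constructor <;> linarith [h1.1, h1.2, h4.1, h4.2, h5.1, h5.2]

/-! ### From null trees to the null index -/

theorem condTreeMax_of_condTreeCont {K : Set (StrongDual ℝ X)} {Fam : Set (Finset ℕ)}
    (h : condTreeCont K Fam) : condTreeMax K Fam := by
  obtain ⟨ε, hε, h⟩ := h
  refine ⟨ε, hε, fun S hS hsep => ?_⟩
  obtain ⟨x, y, hx, hy, -, hxy⟩ := h S hS hsep
  exact ⟨x, y, hx, fun E hE => hy E hE.1, fun E hE => hxy E hE.1⟩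

/-- The induction is on subtrees: `t` is the branch already read and `m` a threshold, only sets
above `m` being relevant. The threshold absorbs the tail condition in the limit families. -/
theorem mem_derivIter_normedTree {F : Ordinal.{0} → Set (Finset ℕ)} (hF : IsFineSchreier F)
    {K S : Set (StrongDual ℝ X)} {ε : ℝ} {ξ : Ordinal.{0}} (hξ : ξ < ω₁) (x : Finset ℕ → X)
    (t : List X) (m : ℕ) (ht : ∀ w ∈ t, ‖w‖ ≤ 1)
    (hx : ∀ E ∈ F ξ, (∀ k ∈ E, m < k) → E ≠ ∅ → ‖x E‖ ≤ 1)
    (hnull : ∀ E ∈ F ξ, (∀ k ∈ E, m < k) →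
      (∃ n, m < n ∧ (∀ k ∈ E, k < n) ∧ insert n E ∈ F ξ) →
      ∀ f ∈ S, Tendsto (fun n : ℕ => f (x (insert n E))) atTop (𝓝 0))
    (hK : ∀ E ∈ F ξ, (∀ k ∈ E, m < k) → ∃ f ∈ K, (∀ w ∈ t, ε ≤ f w) ∧
      ∀ G, IsPrefix G E → G ≠ ∅ → ε ≤ f (x G)) :
    t ∈ derivIter (seqDeriv (nullSeqs S)) (normedTree K ε) ξ := by
  induction ξ using Ordinal.limitRecOn generalizing x t m with
  | zero =>
    rw [derivIter_zero]
    obtain ⟨f, hf, h, -⟩ := hK ∅ (hF.empty_mem hξ) (by simp)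
    exact ⟨ht, f, hf, h⟩
  | add_one ξ ih =>
    have hξ' : ξ < ω₁ := lt_of_le_of_lt le_self_add hξ
    have hsub := hF.subset_add_one hξ'
    have hins : ∀ {n : ℕ} {B : Finset ℕ}, m < n → (∀ k ∈ B, n < k) → B ∈ F ξ → insert n B ∈ F (ξ + 1) :=
      fun hn hB h => (hF.insert_mem_add_one_iff hξ' (by omega) hB).2 h
    have hlt : ∀ {n : ℕ} {B : Finset ℕ}, m < n → (∀ k ∈ B, n < k) → ∀ k ∈ insert n B, m < k := by
      intro n B hn hB k hk
      rcases Finset.mem_insert.1 hk with rfl | hk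
      · exact hn
      · exact hn.trans (hB k hk)
    have hsing : ∀ {n : ℕ}, m < n → insert n ∅ ∈ F (ξ + 1) := fun hn =>
      hins hn (by simp) (hF.empty_mem hξ')
    rw [derivIter_add_one]
    refine ⟨ih hξ' x t m ht (fun E hE => hx E (hsub hE)) (fun E hE hm hn => ?_)
      (fun E hE => hK E (hsub hE)), fun i => x (insert (i + (m + 1)) ∅), ⟨fun i => ?_, ?_⟩,
      fun i => ?_⟩
    · obtain ⟨n, h1, h2, h3⟩ := hn
      exact hnull E (hsub hE) hm ⟨n, h1, h2, hsub h3⟩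
    · exact hx _ (hsing (by omega)) (hlt (by omega) (by simp)) (Finset.insert_ne_empty _ _)
    · intro f hf
      exact (tendsto_add_atTop_iff_nat (m + 1)).2 (hnull ∅ (hF.empty_mem hξ) (by simp)
        ⟨m + 1, by omega, by simp, hsing (by omega)⟩ f hf)
    · have hn : m < i + (m + 1) := by omega
      beta_reduce
      generalize i + (m + 1) = n at hn ⊢
      -- The subtree at `{n}` is indexed by members of `F ξ` above `n`, so `n` becomes the new
      -- threshold.
      refine ih hξ' (fun B => x (insert n B)) (t ++ [x (insert n ∅)]) n ?_ ?_ ?_ ?_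
      · intro w hw
        rcases List.mem_append.1 hw with hw | hw
        · exact ht w hw
        · rw [List.mem_singleton.1 hw]
          exact hx _ (hsing hn) (hlt hn (by simp)) (Finset.insert_ne_empty _ _)
      · intro B hB hBn _
        exact hx _ (hins hn hBn hB) (hlt hn hBn) (Finset.insert_ne_empty _ _)
      · rintro B hB hBn ⟨p, hp, hBp, hpB⟩ f hf
        have hpn : ∀ k ∈ insert p B, n < k := by
          intro k hk
          rcases Finset.mem_insert.1 hk with rfl | hk
          · exact hp
          · exact hBn k hk
        have := hnull (insert n B) (hins hn hBn hB) (hlt hn hBn) ⟨p, hn.trans hp, ?_, ?_⟩ f hf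
        · refine this.congr fun k => ?_
          rw [Finset.insert_comm]
        · intro k hk
          rcases Finset.mem_insert.1 hk with rfl | hk
          · exact hp
          · exact hBp k hk
        · rw [Finset.insert_comm]
          exact hins hn hpn hpB
      · intro B hB hBn
        obtain ⟨f, hf, hft, hfx⟩ := hK (insert n B) (hins hn hBn hB) (hlt hn hBn)
        refine ⟨f, hf, fun w hw => ?_, fun G hG hne => ?_⟩
        · rcases List.mem_append.1 hw with hw | hw
          · exact hft w hw
          · rw [List.mem_singleton.1 hw]
            exact hfx _ ((isPrefix_insert_iff (by simp) hBn).2 (isPrefix_empty B))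
              (Finset.insert_ne_empty _ _)
        · exact hfx _ ((isPrefix_insert_iff (fun k hk => hBn k (hG.1 hk)) hBn).2 hG)
            (Finset.insert_ne_empty _ _)
  | limit ξ hlim ih =>
    obtain ⟨s, hmono, hs, hcof, -, he⟩ := hF.limit ξ hξ hlim
    rw [derivIter_limit _ _ hlim]
    refine mem_iInter₂.2 fun ζ hζ => ?_
    obtain ⟨j, hj⟩ := hcof ζ hζ
    refine derivIter_antitone (fun _ => seqDeriv_subset _ _)
      (hj.le.trans (hmono (le_max_left j (m + 1)))) ?_
    -- An index `n ≥ m + 1` makes sets above `n` lie above `m`, and gives `n ≥ 1` as the diagonal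
    -- family requires.
    have hn : m + 1 ≤ max j (m + 1) := le_max_right _ _
    generalize max j (m + 1) = n at hn
    have hmem : ∀ E ∈ F (s n), (∀ k ∈ E, n < k) → E ∈ F ξ := by
      intro E hE hk
      rw [he]
      exact ⟨n, by omega, fun k hk' => (hk k hk').le, hE⟩
    have hm : ∀ E : Finset ℕ, (∀ k ∈ E, n < k) → ∀ k ∈ E, m < k := fun E hE k hk => by
      have := hE k hk
      omega
    refine ih (s n) (hs n) ((hs n).trans hξ) x t n ht
      (fun E hE hEn => hx E (hmem E hE hEn) (hm E hEn)) (fun E hE hEn hp => ?_)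
      (fun E hE hEn => hK E (hmem E hE hEn) (hm E hEn))
    obtain ⟨p, hp, hEp, hpE⟩ := hp
    refine hnull E (hmem E hE hEn) (hm E hEn) ⟨p, by omega, hEp, hmem _ hpE fun k hk => ?_⟩
    rcases Finset.mem_insert.1 hk with rfl | hk
    · exact hp
    · exact hEn k hk

theorem condNullIndex_of_condTreeMax {F : Ordinal.{0} → Set (Finset ℕ)} (hF : IsFineSchreier F)
    {K : Set (StrongDual ℝ X)} {ξ : Ordinal.{0}} (hξ : ξ < ω₁) (h : condTreeMax K (F ξ)) :
    condNullIndex K ξ := by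
  obtain ⟨ε, hε, h⟩ := h
  refine ⟨ε, hε, fun S hS hsep => ?_⟩
  obtain ⟨x, y, ⟨hx, hnull⟩, hy, hxy⟩ := h S hS hsep
  refine lt_seqIndex hξ ⟨[], mem_derivIter_normedTree hF hξ x [] 0 (by simp)
    (fun E hE _ hne => hx E hE hne) (fun E hE _ hn f hf => ?_) fun E hE _ => ?_⟩
  · obtain ⟨n, -, hEn, hnE⟩ := hn
    refine hnull E ⟨hE, fun hmax => ?_⟩ f hf
    have := hmax.2 _ hnE (isPrefix_insert_of_lt hEn)
    exact lt_irrefl n (hEn n (this ▸ Finset.mem_insert_self n E))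
  -- The functional of any maximal extension norms all initial segments of `E` as well.
  · obtain ⟨M, hM, hEM⟩ := hF.exists_maxMember hξ hE
    exact ⟨y M, hy M hM, by simp, fun G hG hne => hxy M hM G (hG.trans hEM) hne⟩

end Trees

/-! ### From the tree indices back to the Szlenk index -/

section Indices

variable {X : Type*} [NormedAddCommGroup X] [NormedSpace ℝ X]

theorem nullSeqs_subset_radiusSeqs (S : Set (StrongDual ℝ X)) {r : ℝ} (hr : 0 ≤ r) :
    nullSeqs S ⊆ radiusSeqs S r := by
  rintro x ⟨hx, h⟩
  refine ⟨hx, fun f hf => ?_⟩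
  have := (h f hf).abs
  rw [abs_zero] at this
  exact this.limsup_eq.trans_le hr

theorem condRadiusIndex_of_condNullIndex {K : Set (StrongDual ℝ X)} {ξ : Ordinal.{0}}
    (hξ : ξ < ω₁) (h : condNullIndex K ξ) : condRadiusIndex K ξ := by
  obtain ⟨ε, hε, h⟩ := h
  refine ⟨ε / 2, ε, half_pos hε, half_lt_self hε, fun S hS hsep => lt_seqIndex hξ ?_⟩
  exact (derivIter_nonempty hξ (h S hS hsep)).mono
    (derivIter_seqDeriv_mono (nullSeqs_subset_radiusSeqs S (half_pos hε).le) _ ξ)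

theorem eventually_abs_lt_of_mem_radiusSeqs {S : Set (StrongDual ℝ X)} {r : ℝ} {x : ℕ → X}
    (hx : x ∈ radiusSeqs S r) {f : StrongDual ℝ X} (hf : f ∈ S) {s : ℝ} (hs : r < s) :
    ∀ᶠ n in atTop, |f (x n)| < s := by
  refine eventually_lt_of_limsup_lt ((hx.2 f hf).trans_lt hs) ?_
  exact isBoundedUnder_of ⟨‖f‖, fun n => abs_apply_le_of_norm_le_one f (hx.1 n)⟩

/-- The members of a set of functionals that are at least `ε` on all terms of a list. -/
def normingPart (L : Set (StrongDual ℝ X)) (ε : ℝ) (t : List X) : Set (WeakDual ℝ X) :=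
  {g | WeakDual.toStrongDual g ∈ L ∧ ∀ w ∈ t, ε ≤ g w}

theorem isClosed_normingPart {L : Set (StrongDual ℝ X)} (hL : IsWeakStarClosed L) (ε : ℝ)
    (t : List X) : IsClosed (normingPart L ε t) := by
  have : normingPart L ε t = {g : WeakDual ℝ X | WeakDual.toStrongDual g ∈ L} ∩
      ⋂ w ∈ t, {g : WeakDual ℝ X | ε ≤ g w} := by
    ext g
    simp [normingPart]
  rw [this]
  exact IsClosed.inter hL
    (isClosed_biInter fun w _ => isClosed_le continuous_const (WeakDual.eval_continuous w))

theorem isCompact_normingPart {K L : Set (StrongDual ℝ X)} (hK : IsWeakStarCompact K)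
    (hLK : L ⊆ K) (hL : IsWeakStarClosed L) (ε : ℝ) (t : List X) :
    IsCompact (normingPart L ε t) :=
  hK.of_isClosed_subset (isClosed_normingPart hL ε t) fun _ hg => ⟨_, hLK hg.1, rfl⟩

/-- A list in an iterated derivative of the tree is normed by a functional in the corresponding
iterated Szlenk derivative. -/
theorem normingPart_nonempty_of_mem_derivIter {K S : Set (StrongDual ℝ X)}
    (hK : IsWeakStarCompact K) (hKS : K ⊆ S) {r ε δ : ℝ} (hδ0 : 0 ≤ δ) (hδ : δ < ε - r)
    (ξ : Ordinal.{0}) (t : List X)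
    (ht : t ∈ derivIter (seqDeriv (radiusSeqs S r)) (normedTree K ε) ξ) :
    (normingPart (derivIter (szlenkDeriv δ) K ξ) ε t).Nonempty := by
  have hcl := hK.isWeakStarClosed
  induction ξ using Ordinal.limitRecOn generalizing t with
  | zero =>
    rw [derivIter_zero] at ht ⊢
    obtain ⟨-, f, hf, h⟩ := ht
    exact ⟨StrongDual.toWeakDual f, hf, h⟩
  | add_one ξ ih =>
    rw [derivIter_add_one] at ht
    obtain ⟨-, x, hx, hxt⟩ := ht
    choose u hu using fun i => ih _ (hxt i)
    have hut : ∀ i, u i ∈ normingPart (derivIter (szlenkDeriv δ) K ξ) ε t :=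
      fun i => ⟨(hu i).1, fun w hw => (hu i).2 w (List.mem_append_left _ hw)⟩
    have hcomp := isCompact_normingPart hK (derivIter_szlenkDeriv_subset hcl δ ξ)
      (isWeakStarClosed_derivIter hcl δ ξ) ε t
    obtain ⟨f, hf, hcluster⟩ := hcomp.exists_mapClusterPt (f := atTop) (u := u)
      (le_principal_iff.2 (mem_map.2 (univ_mem' hut)))
    refine ⟨f, ?_, hf.2⟩
    rw [derivIter_add_one]
    intro V hV
    -- This is where `K ⊆ S` enters: eventually `|f (x i)| < ε - δ`, while `u i (x i) ≥ ε`, so `u i`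
    -- is at distance more than `δ` from `f`.
    have hfS : WeakDual.toStrongDual f ∈ S := hKS (derivIter_szlenkDeriv_subset hcl δ ξ hf.1)
    have hev := eventually_abs_lt_of_mem_radiusSeqs hx hfS (show r < ε - δ by linarith)
    obtain ⟨i, hiV, hi⟩ := ((mapClusterPt_iff_frequently.1 hcluster V hV).and_eventually hev).exists
    have h1 : ε ≤ WeakDual.toStrongDual (u i) (x i) := (hu i).2 (x i) (by simp)
    have h2 := abs_apply_le_of_norm_le_one
      (WeakDual.toStrongDual (u i) - WeakDual.toStrongDual f) (hx.1 i)
    rw [sub_apply] at h2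
    have h3 := (le_abs_self _).trans h2
    rw [abs_lt] at hi
    have h4 : WeakDual.toStrongDual f (x i) < ε - δ := hi.2
    have h5 : δ < ‖WeakDual.toStrongDual (u i) - WeakDual.toStrongDual f‖ := by linarith
    refine lt_of_lt_of_le ?_ (Metric.edist_le_ediam_of_mem
      (x := WeakDual.toStrongDual (u i)) (y := WeakDual.toStrongDual f)
      ⟨hiV, (hu i).1⟩ ⟨mem_of_mem_nhds hV, hf.1⟩)
    rw [edist_dist, dist_eq_norm]
    exact (ENNReal.ofReal_lt_ofReal_iff (hδ0.trans_lt h5)).2 h5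
  | limit ξ hlim ih =>
    rw [derivIter_limit _ _ hlim] at ht
    have hne : Nonempty (Iio ξ) := ⟨⟨0, hlim.bot_lt⟩⟩
    -- The norming parts at the stages below `ξ` are nested, nonempty and weak* compact.
    obtain ⟨g, hg⟩ := IsCompact.nonempty_iInter_of_directed_nonempty_isCompact_isClosed
      (fun ζ : Iio ξ => normingPart (derivIter (szlenkDeriv δ) K ζ) ε t)
      (directed_of_isDirected_le fun a b hab g hg =>
        ⟨derivIter_szlenkDeriv_antitone hcl δ hab hg.1, hg.2⟩)
      (fun ζ => ih ζ ζ.2 t (mem_iInter₂.1 ht ζ ζ.2))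
      (fun ζ => isCompact_normingPart hK (derivIter_szlenkDeriv_subset hcl δ ζ)
        (isWeakStarClosed_derivIter hcl δ ζ) ε t)
      (fun ζ => isClosed_normingPart (isWeakStarClosed_derivIter hcl δ ζ) ε t)
    rw [mem_iInter] at hg
    refine ⟨g, ?_, (hg ⟨0, hlim.bot_lt⟩).2⟩
    rw [derivIter_limit _ _ hlim]
    exact mem_iInter₂.2 fun ζ hζ => (hg ⟨ζ, hζ⟩).1

theorem condSzlenk_of_lt_radiusIndex {K S : Set (StrongDual ℝ X)} (hK : IsWeakStarCompact K)
    (hKS : K ⊆ S) {r ε : ℝ} (hr : r < ε) {ξ : Ordinal.{0}} (hξ : ξ < ω₁)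
    (h : ξ < radiusIndex S r (normedTree K ε)) : condSzlenk K ξ := by
  obtain ⟨t, ht⟩ := derivIter_nonempty hξ h
  refine ⟨(ε - r) / 2, by linarith, lt_derivIndex
    (szlenkDeriv_derivIter_subset hK.isWeakStarClosed _) hξ ?_⟩
  obtain ⟨g, hg⟩ := normingPart_nonempty_of_mem_derivIter hK hKS
    (show 0 ≤ (ε - r) / 2 by linarith) (show (ε - r) / 2 < ε - r by linarith) ξ t ht
  exact ⟨_, hg.1⟩

theorem condSzlenk_of_lt_nullIndex {K S : Set (StrongDual ℝ X)} (hK : IsWeakStarCompact K)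
    (hKS : K ⊆ S) {ε : ℝ} (hε : 0 < ε) {ξ : Ordinal.{0}} (hξ : ξ < ω₁)
    (h : ξ < nullIndex S (normedTree K ε)) : condSzlenk K ξ := by
  refine condSzlenk_of_lt_radiusIndex hK hKS hε hξ (lt_seqIndex hξ ?_)
  exact (derivIter_nonempty hξ h).mono
    (derivIter_seqDeriv_mono (nullSeqs_subset_radiusSeqs S le_rfl) _ ξ)

/-! ### Sets of functionals with small Szlenk index are norm separable -/

theorem isSeparable_of_countable_cover {Y : Type*} [PseudoEMetricSpace Y] {s : Set Y}
    (h : ∀ ε : ℝ, 0 < ε → ∃ 𝒜 : Set (Set Y), 𝒜.Countable ∧ s ⊆ ⋃₀ 𝒜 ∧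
      ∀ A ∈ 𝒜, Metric.ediam A ≤ ENNReal.ofReal ε) : TopologicalSpace.IsSeparable s := by
  obtain ⟨t, -, htc, hst⟩ := EMetric.subset_countable_closure_of_almost_dense_set s fun ε hε => by
    obtain ⟨δ, -, hδ, hδε⟩ := ENNReal.lt_iff_exists_real_btwn.1 hε
    obtain ⟨𝒜, hc, hs, hd⟩ := h δ (ENNReal.ofReal_pos.1 hδ)
    let p : 𝒜 → Set Y := fun A => open Classical in
      if hA : A.1.Nonempty then {hA.some} else ∅
    have hp : ∀ A, (p A).Countable := by
      intro A
      by_cases hA : A.1.Nonempty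
      · simp [p, hA]
      · simp [p, hA]
    have : Countable 𝒜 := hc.to_subtype
    refine ⟨⋃ A, p A, countable_iUnion hp, fun y hy => ?_⟩
    obtain ⟨A, hA, hyA⟩ := hs hy
    have hne : A.Nonempty := ⟨y, hyA⟩
    refine mem_iUnion₂.2 ⟨hne.some, mem_iUnion.2 ⟨⟨A, hA⟩, by simp [p, hne]⟩, ?_⟩
    exact (Metric.edist_le_ediam_of_mem hyA hne.some_mem).trans ((hd A hA).trans hδε.le)
  exact ⟨t, htc, hst⟩

/-- Evaluation on a dense sequence embeds the compact set in `ℝ^ℕ`. -/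
theorem IsWeakStarCompact.secondCountable [TopologicalSpace.SeparableSpace X]
    {K : Set (StrongDual ℝ X)} (hK : IsWeakStarCompact K) :
    SecondCountableTopology ((fun f : StrongDual ℝ X => StrongDual.toWeakDual f) '' K) := by
  have : CompactSpace ((fun f : StrongDual ℝ X => StrongDual.toWeakDual f) '' K) :=
    isCompact_iff_compactSpace.1 hK
  let Φ : ((fun f : StrongDual ℝ X => StrongDual.toWeakDual f) '' K) → ℕ → ℝ :=
    fun g i => g.1 (TopologicalSpace.denseSeq X i)
  have hΦ : Continuous Φ :=
    continuous_pi fun i => (WeakDual.eval_continuous _).comp continuous_subtype_val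
  have hinj : Function.Injective Φ := by
    intro a b hab
    apply Subtype.ext
    apply DFunLike.coe_injective
    refine (TopologicalSpace.denseRange_denseSeq X).equalizer
      (WeakDual.toStrongDual a.1).continuous (WeakDual.toStrongDual b.1).continuous ?_
    exact hab
  exact (hΦ.isClosedEmbedding hinj).isEmbedding.secondCountableTopology

/-- Each point of `K` is lost at some stage `ζ < ξ`, so a basic weak* open set around it meets stage
`ζ` in diameter at most `ε`. There are countably many pairs of a basic set and a stage. -/
theorem isSeparable_of_not_condSzlenk [TopologicalSpace.SeparableSpace X]
    {K : Set (StrongDual ℝ X)} (hK : IsWeakStarCompact K) {ξ : Ordinal.{0}} (hξ : ξ < ω₁)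
    (h : ¬ condSzlenk K ξ) : TopologicalSpace.IsSeparable K := by
  have hcl := hK.isWeakStarClosed
  have := hK.secondCountable
  refine isSeparable_of_countable_cover fun ε hε => ?_
  have hempty : derivIter (szlenkDeriv ε) K ξ = ∅ := by
    by_contra hne
    exact h ⟨ε, hε, lt_derivIndex (szlenkDeriv_derivIter_subset hcl ε) hξ
      (nonempty_iff_ne_empty.2 hne)⟩
  let Y := ((fun f : StrongDual ℝ X => StrongDual.toWeakDual f) '' K)
  let A : Set Y × Ordinal.{0} → Set (StrongDual ℝ X) := fun q =>
    {f | StrongDual.toWeakDual f ∈ ((↑) '' q.1 : Set (WeakDual ℝ X)) ∧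
      f ∈ derivIter (szlenkDeriv ε) K q.2}
  refine ⟨{B | Metric.ediam B ≤ ENNReal.ofReal ε} ∩
    A '' (TopologicalSpace.countableBasis Y ×ˢ Iio ξ), ?_, fun f hf => ?_, fun B hB => hB.1⟩
  · exact (((TopologicalSpace.countable_countableBasis Y).prod
      (countable_Iio_of_lt_omega_one hξ)).image A).mono inter_subset_right
  · obtain ⟨ζ, hζ, hmem, hnot⟩ : ∃ ζ < ξ, f ∈ derivIter (szlenkDeriv ε) K ζ ∧
        f ∉ derivIter (szlenkDeriv ε) K (ζ + 1) := by
      by_contra hcon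
      push Not at hcon
      have : ∀ η ≤ ξ, f ∈ derivIter (szlenkDeriv ε) K η := by
        intro η
        induction η using Ordinal.limitRecOn with
        | zero => exact fun _ => by rwa [derivIter_zero]
        | add_one η ih =>
          intro hη
          have hη' : η < ξ := lt_of_lt_of_le (by simp) hη
          exact hcon η hη' (ih hη'.le)
        | limit η hlim ih =>
          intro hη
          rw [derivIter_limit _ _ hlim]
          exact mem_iInter₂.2 fun ζ hζ => ih ζ hζ (hζ.le.trans hη)
      have := this ξ le_rfl
      rw [hempty] at this
      exact this
    rw [derivIter_add_one] at hnot
    simp only [szlenkDeriv, mem_ofPred_eq, not_forall, not_lt] at hnot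
    obtain ⟨V, hV, hd⟩ := hnot
    let f' : Y := ⟨StrongDual.toWeakDual f, f, hf, rfl⟩
    obtain ⟨U, hU, hfU, hUV⟩ := (TopologicalSpace.isBasis_countableBasis Y).mem_nhds_iff.1
      (continuous_subtype_val.continuousAt.preimage_mem_nhds (x := f') hV)
    refine ⟨A (U, ζ), ⟨(Metric.ediam_mono ?_).trans hd, (U, ζ), ⟨hU, hζ⟩, rfl⟩,
      ⟨f', hfU, rfl⟩, hmem⟩
    rintro g ⟨⟨g', hg', he⟩, hg⟩
    refine ⟨?_, hg⟩
    rw [← he]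
    exact hUV hg'

end Indices

/-! ### Oscillation and independence of sequences of sets -/

section Oscillation

/-- Diagonal argument: the properties pass to almost contained sets, and the diagonal set is almost
contained in each set of a decreasing sequence. -/
theorem exists_infinite_subset_forall {ι : Type*} [Countable ι] [Nonempty ι]
    {P : ι → Set ℕ → Prop} (hmono : ∀ k L M, (L \ M).Finite → P k M → P k L)
    (hstep : ∀ k M, M.Infinite → ∃ L ⊆ M, L.Infinite ∧ P k L) {M : Set ℕ} (hM : M.Infinite) :
    ∃ L ⊆ M, L.Infinite ∧ ∀ k, P k L := by
  obtain ⟨e, he⟩ := exists_surjective_nat ι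
  choose! c hc using hstep
  let m : ℕ → Set ℕ := fun k => Nat.rec M (fun j N => c (e j) N) k
  have hm : ∀ k, m (k + 1) = c (e k) (m k) := fun k => rfl
  have hinf : ∀ k, (m k).Infinite := by
    intro k
    induction k with
    | zero => exact hM
    | succ k ih => rw [hm]; exact (hc _ _ ih).2.1
  have hanti : Antitone m := antitone_nat_of_succ_le fun k => by
    rw [hm]; exact (hc _ _ (hinf k)).1
  obtain ⟨φ, hφ, hφm⟩ := extraction_forall_of_frequently (P := fun k n => n ∈ m k) fun k =>
    Nat.frequently_atTop_iff_infinite.2 (hinf k)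
  refine ⟨range φ, ?_, infinite_range_of_injective hφ.injective, fun k => ?_⟩
  · rintro _ ⟨k, rfl⟩
    exact hanti (Nat.zero_le k) (hφm k)
  · obtain ⟨j, rfl⟩ := he k
    refine hmono _ _ (m (j + 1)) (((finite_Iio (j + 1)).image φ).subset ?_)
      (by rw [hm]; exact (hc _ _ (hinf j)).2.2)
    rintro _ ⟨⟨i, rfl⟩, hi⟩
    refine ⟨i, ?_, rfl⟩
    by_contra hle
    exact hi (hanti (not_lt.1 hle) (hφm i))

variable {Ω : Type*} (A B : ℕ → Set Ω)

/-- The points that lie in infinitely many `A n` and in infinitely many `B n`, `n ∈ L`. -/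
def oscSet (L : Set ℕ) : Set Ω :=
  {z | {n ∈ L | z ∈ A n}.Infinite ∧ {n ∈ L | z ∈ B n}.Infinite}

theorem oscSet_mono {L M : Set ℕ} (h : (L \ M).Finite) : oscSet A B L ⊆ oscSet A B M := by
  have key : ∀ C : ℕ → Set Ω, ∀ z, {n ∈ L | z ∈ C n}.Infinite → {n ∈ M | z ∈ C n}.Infinite := by
    intro C z hinf hfin
    refine hinf ((hfin.union h).subset fun n hn => ?_)
    by_cases hM : n ∈ M
    · exact Or.inl ⟨hM, hn.2⟩
    · exact Or.inr ⟨hn.1, hM⟩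
  exact fun z hz => ⟨key A z hz.1, key B z hz.2⟩

/-- The points in all `A n`, `n ∈ P`, and all `B n`, `n ∈ Q`. -/
def cell (q : Finset ℕ × Finset ℕ) : Set Ω := {z | (∀ n ∈ q.1, z ∈ A n) ∧ ∀ n ∈ q.2, z ∈ B n}

/-- Oscillation inside a cell persists along all infinite subsets. -/
def PersistsIn (L : Set ℕ) (q : Finset ℕ × Finset ℕ) : Prop :=
  ∀ L' : Set ℕ, L'.Infinite → (L' \ L).Finite → (oscSet A B L' ∩ cell A B q).Nonempty

variable {A B}

/-- If oscillation in a cell does not persist, some infinite subset kills it there; diagonalize over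
the countably many cells. Afterwards a single oscillating point in a cell proves persistence. -/
theorem exists_persists_or_empty {M : Set ℕ} (hM : M.Infinite) :
    ∃ L ⊆ M, L.Infinite ∧
      ∀ q, PersistsIn A B L q ∨ oscSet A B L ∩ cell A B q = ∅ := by
  refine exists_infinite_subset_forall (fun q L N h hP => ?_) (fun q N hN => ?_) hM
  · rcases hP with hP | hP
    · refine Or.inl fun L' hL' hfin => hP L' hL' ((hfin.union h).subset fun n hn => ?_)
      by_cases hL : n ∈ L
      · exact Or.inr ⟨hL, hn.2⟩
      · exact Or.inl ⟨hn.1, hL⟩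
    · exact Or.inr (subset_empty_iff.1 (hP ▸ inter_subset_inter_left _ (oscSet_mono A B h)))
  · by_cases h : PersistsIn A B N q
    · exact ⟨N, subset_rfl, hN, Or.inl h⟩
    · simp only [PersistsIn, not_forall] at h
      obtain ⟨L', hL', hfin, hemp⟩ := h
      have hinf : (L' ∩ N).Infinite := by
        intro hf
        exact hL' ((hf.union hfin).subset fun n hn => by
          by_cases hn' : n ∈ N
          · exact Or.inl ⟨hn, hn'⟩
          · exact Or.inr ⟨hn, hn'⟩)
      refine ⟨L' ∩ N, inter_subset_right, hinf, Or.inr ?_⟩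
      rw [not_nonempty_iff_eq_empty] at hemp
      refine subset_empty_iff.1 (hemp ▸ inter_subset_inter_left _ (oscSet_mono A B ?_))
      rw [sdiff_eq_empty.2 inter_subset_left]
      exact finite_empty

theorem PersistsIn.of_mem {L : Set ℕ} {q : Finset ℕ × Finset ℕ}
    (hL : PersistsIn A B L q ∨ oscSet A B L ∩ cell A B q = ∅) {z : Ω}
    (h1 : z ∈ oscSet A B L) (h2 : z ∈ cell A B q) : PersistsIn A B L q := by
  refine hL.resolve_right fun h => ?_
  have : z ∈ oscSet A B L ∩ cell A B q := ⟨h1, h2⟩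
  rw [h] at this
  exact this

theorem exists_split {L : Set ℕ}
    (hL : ∀ q, PersistsIn A B L q ∨ oscSet A B L ∩ cell A B q = ∅)
    (T : Finset (Finset ℕ × Finset ℕ)) (hT : ∀ q ∈ T, PersistsIn A B L q)
    {L' : Set ℕ} (hL' : L'.Infinite) (hsub : L' ⊆ L) :
    ∃ N ⊆ L', N.Infinite ∧ ∀ n ∈ N, ∀ q ∈ T, PersistsIn A B L (insert n q.1, q.2) ∧
      PersistsIn A B L (q.1, insert n q.2) := by
  classical
  have hfin : ∀ N : Set ℕ, N ⊆ L → (N \ L).Finite := fun N hN => by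
    rw [sdiff_eq_empty.2 hN]
    exact finite_empty
  induction T using Finset.induction_on with
  | empty => exact ⟨L', subset_rfl, hL', by simp⟩
  | insert q T _ ih =>
    obtain ⟨N, hN, hNinf, hNT⟩ := ih fun q hq => hT q (Finset.mem_insert_of_mem hq)
    have hq := hT q (Finset.mem_insert_self q T)
    have hNL := hN.trans hsub
    obtain ⟨z, hz, hzq⟩ := hq N hNinf (hfin N hNL)
    -- Persistence is used a second time along the infinite set where `z ∈ A n`, so that infinitely
    -- many `n` have both `z ∈ A n` and `z' ∈ B n`; for these, `z` and `z'` witness the two refined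
    -- cells.
    obtain ⟨z', hz', hzq'⟩ := hq {n ∈ N | z ∈ A n} hz.1 (hfin _ fun n hn => hNL hn.1)
    refine ⟨{n ∈ {n ∈ N | z ∈ A n} | z' ∈ B n}, fun n hn => hN hn.1.1, hz'.2, ?_⟩
    rintro n ⟨⟨hn, hnA⟩, hnB⟩ p hp
    rcases Finset.mem_insert.1 hp with rfl | hp
    · refine ⟨PersistsIn.of_mem (hL _) (oscSet_mono A B (hfin N hNL) hz) ⟨?_, hzq.2⟩,
        PersistsIn.of_mem (hL _) (oscSet_mono A B (hfin _ fun n hn => hNL hn.1) hz')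
          ⟨hzq'.1, ?_⟩⟩
      · intro k hk
        rcases Finset.mem_insert.1 hk with rfl | hk
        · exact hnA
        · exact hzq.1 k hk
      · intro k hk
        rcases Finset.mem_insert.1 hk with rfl | hk
        · exact hnB
        · exact hzq'.2 k hk
    · exact hNT n hn p hp

/-- If points oscillate along every infinite subset of `M`, then some subsequence of the pairs
`(A n, B n)` is independent. -/
theorem exists_independent_subsequence {M : Set ℕ} (hM : M.Infinite)
    (h : ∀ L ⊆ M, L.Infinite → (oscSet A B L).Nonempty) :
    ∃ φ : ℕ → ℕ, StrictMono φ ∧ ∀ P Q : Finset ℕ, Disjoint P Q →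
      ∃ z, (∀ k ∈ P, z ∈ A (φ k)) ∧ ∀ k ∈ Q, z ∈ B (φ k) := by
  classical
  obtain ⟨L, hLM, hLinf, hL⟩ := exists_persists_or_empty (A := A) (B := B) hM
  -- All `2^|D|` sign patterns on `D` persist. Splitting them simultaneously allows `D` to grow
  -- forever, which is independence.
  let Good : Finset ℕ → Prop := fun D => ∀ P ⊆ D, PersistsIn A B L (P, D \ P)
  have hgood : Good ∅ := by
    intro P hP
    rw [Finset.subset_empty.1 hP]
    intro L' hL' hfin
    have hinf : (L' ∩ L).Infinite := by
      intro hf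
      exact hL' ((hf.union hfin).subset fun n hn => by
        by_cases hn' : n ∈ L
        · exact Or.inl ⟨hn, hn'⟩
        · exact Or.inr ⟨hn, hn'⟩)
    obtain ⟨z, hz⟩ := h (L' ∩ L) (inter_subset_right.trans hLM) hinf
    refine ⟨z, oscSet_mono A B ?_ hz, by simp [cell]⟩
    rw [sdiff_eq_empty.2 inter_subset_left]
    exact finite_empty
  have hext : ∀ D, Good D → ∃ n, (∀ k ∈ D, k < n) ∧ Good (insert n D) := by
    intro D hD
    obtain ⟨N, -, hNinf, hN⟩ := exists_split hL (D.powerset.image fun P => (P, D \ P))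
      (by
        intro q hq
        obtain ⟨P, hP, rfl⟩ := Finset.mem_image.1 hq
        exact hD P (Finset.mem_powerset.1 hP)) hLinf subset_rfl
    obtain ⟨n, hn, hnD⟩ := hNinf.exists_gt (D.sup id)
    have hlt : ∀ k ∈ D, k < n := fun k hk => (Finset.le_sup (f := id) hk).trans_lt hnD
    have hnD' : n ∉ D := fun hn => lt_irrefl n (hlt n hn)
    refine ⟨n, hlt, fun P hP => ?_⟩
    by_cases hnP : n ∈ P
    · have h1 := (hN n hn (P.erase n, D \ P.erase n) (Finset.mem_image_of_mem _
        (Finset.mem_powerset.2 fun k hk => (Finset.mem_insert.1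
          (hP (Finset.mem_erase.1 hk).2)).resolve_left (Finset.mem_erase.1 hk).1))).1
      have h2 : D \ P.erase n = insert n D \ P := by
        ext k
        simp only [Finset.mem_sdiff, Finset.mem_erase, Finset.mem_insert]
        by_cases hk : k = n
        · subst hk
          simp [hnP, hnD']
        · simp [hk]
      rwa [Finset.insert_erase hnP, h2] at h1
    · have h1 := (hN n hn (P, D \ P) (Finset.mem_image_of_mem _
        (Finset.mem_powerset.2 fun k hk => (Finset.mem_insert.1
          (hP hk)).resolve_left fun h => hnP (h ▸ hk)))).2
      rwa [← Finset.insert_sdiff_of_notMem D hnP] at h1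
  choose! g hg using hext
  let D : ℕ → Finset ℕ := fun k => Nat.rec ∅ (fun _ E => insert (g E) E) k
  have hDsucc : ∀ k, D (k + 1) = insert (g (D k)) (D k) := fun k => rfl
  have hDgood : ∀ k, Good (D k) := by
    intro k
    induction k with
    | zero => exact hgood
    | succ k ih => rw [hDsucc]; exact (hg _ ih).2
  have hDmono : Monotone D := monotone_nat_of_le_succ fun k => by
    rw [hDsucc]; exact Finset.subset_insert _ _
  have hmem : ∀ {i j}, i < j → g (D i) ∈ D j := fun {i j} hij =>
    hDmono (Nat.succ_le_of_lt hij) (by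
      change g (D i) ∈ D (i + 1)
      rw [hDsucc]; exact Finset.mem_insert_self _ _)
  have hφ : StrictMono fun k => g (D k) := fun i j hij => (hg _ (hDgood j)).1 _ (hmem hij)
  refine ⟨fun k => g (D k), hφ, fun P Q hPQ => ?_⟩
  have hlt : ∀ k ∈ P ∪ Q, k < (P ∪ Q).sup id + 1 := fun k hk =>
    Nat.lt_succ_of_le (Finset.le_sup (f := id) hk)
  generalize (P ∪ Q).sup id + 1 = m at hlt
  obtain ⟨z, -, hz⟩ := hDgood m (P.image fun k => g (D k)) (by
    intro n hn
    obtain ⟨k, hk, rfl⟩ := Finset.mem_image.1 hn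
    exact hmem (hlt k (Finset.mem_union_left Q hk))) L hLinf (by simp)
  refine ⟨z, fun k hk => hz.1 _ (Finset.mem_image_of_mem _ hk), fun k hk => hz.2 _ ?_⟩
  refine Finset.mem_sdiff.2 ⟨hmem (hlt k (Finset.mem_union_right P hk)), fun hmemP => ?_⟩
  obtain ⟨j, hj, hjk⟩ := Finset.mem_image.1 hmemP
  exact Finset.disjoint_left.1 hPQ hj (hφ.injective hjk ▸ hk)

end Oscillation

/-! ### Rosenthal's `ℓ₁` theorem -/

section Rosenthal

variable {X : Type*} [NormedAddCommGroup X] [NormedSpace ℝ X]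

/-- Take `f` separating the indices with `a k ≥ 0` from the others and `f'` doing the opposite; `f -
f'` has norm at most `2` and gains at least `(s - r) * |a k|` in each term. -/
theorem mul_sum_abs_le_norm_sum {w : ℕ → X} {r s : ℝ}
    (h : ∀ P Q : Finset ℕ, Disjoint P Q → ∃ f : StrongDual ℝ X, ‖f‖ ≤ 1 ∧
      (∀ k ∈ P, s < f (w k)) ∧ ∀ k ∈ Q, f (w k) < r) (D : Finset ℕ) (a : ℕ → ℝ) :
    (s - r) / 2 * ∑ k ∈ D, |a k| ≤ ‖∑ k ∈ D, a k • w k‖ := by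
  classical
  have hdisj : Disjoint (D.filter fun k => 0 ≤ a k) (D.filter fun k => ¬ 0 ≤ a k) :=
    Finset.disjoint_filter_filter_not D D fun k => 0 ≤ a k
  obtain ⟨f, hf, hf1, hf2⟩ := h _ _ hdisj
  obtain ⟨f', hf', hf1', hf2'⟩ := h _ _ hdisj.symm
  have hterm : ∀ k ∈ D, (s - r) * |a k| ≤ a k * f (w k) - a k * f' (w k) := by
    intro k hk
    rcases le_or_gt 0 (a k) with hp | hn
    · have h1 := hf1 k (Finset.mem_filter.2 ⟨hk, hp⟩)
      have h2 := hf2' k (Finset.mem_filter.2 ⟨hk, hp⟩)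
      rw [abs_of_nonneg hp]
      nlinarith
    · have h1 := hf2 k (Finset.mem_filter.2 ⟨hk, not_le.2 hn⟩)
      have h2 := hf1' k (Finset.mem_filter.2 ⟨hk, not_le.2 hn⟩)
      rw [abs_of_neg hn]
      nlinarith
  have hsum := Finset.sum_le_sum hterm
  rw [← Finset.mul_sum, Finset.sum_sub_distrib] at hsum
  have hval : ∀ e : StrongDual ℝ X, e (∑ k ∈ D, a k • w k) = ∑ k ∈ D, a k * e (w k) := by
    intro e
    simp
  rw [← hval, ← hval] at hsum
  have hle : ∀ e : StrongDual ℝ X, ‖e‖ ≤ 1 →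
      |e (∑ k ∈ D, a k • w k)| ≤ ‖∑ k ∈ D, a k • w k‖ := by
    intro e he
    have := e.le_of_opNorm_le he (∑ k ∈ D, a k • w k)
    rwa [one_mul, Real.norm_eq_abs] at this
  have h1 := le_abs_self (f (∑ k ∈ D, a k • w k))
  have h2 := neg_abs_le (f' (∑ k ∈ D, a k • w k))
  have h3 := hle f hf
  have h4 := hle f' hf'
  linarith

theorem containsL1_of_le [CompleteSpace X] {w : ℕ → X} (hw : ∀ k, ‖w k‖ ≤ 1) {c : ℝ} (hc : 0 < c)
    (h : ∀ (n : ℕ) (a : ℕ → ℝ),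
      c * ∑ k ∈ Finset.range n, |a k| ≤ ‖∑ k ∈ Finset.range n, a k • w k‖) : ContainsL1 X := by
  have hnorm : ∀ a : lp (fun _ : ℕ => ℝ) 1, HasSum (fun k => |a k|) ‖a‖ := by
    intro a
    have := lp.hasSum_norm (by norm_num : (0 : ℝ) < (1 : ENNReal).toReal) a
    simpa using this
  have hle : ∀ (a : lp (fun _ : ℕ => ℝ) 1) k, ‖a k • w k‖ ≤ |a k| := by
    intro a k
    rw [norm_smul, Real.norm_eq_abs]
    exact mul_le_of_le_one_right (abs_nonneg _) (hw k)
  have hsum : ∀ a : lp (fun _ : ℕ => ℝ) 1, Summable fun k => a k • w k := fun a =>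
    Summable.of_norm_bounded (hnorm a).summable (hle a)
  let T : lp (fun _ : ℕ => ℝ) 1 →ₗ[ℝ] X :=
    { toFun := fun a => ∑' k, a k • w k
      map_add' := fun a b => by
        rw [← (hsum a).tsum_add (hsum b)]
        simp [add_smul]
      map_smul' := fun t a => by
        rw [RingHom.id_apply, ← (hsum a).tsum_const_smul t]
        simp [mul_smul] }
  refine ⟨T.mkContinuous 1 fun a => ?_, c, hc, fun a => ?_⟩
  · rw [one_mul]
    exact tsum_of_norm_bounded (hnorm a) (hle a)
  · refine le_of_tendsto_of_tendsto ((hnorm a).tendsto_sum_nat.const_mul c)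
      (hsum a).hasSum.tendsto_sum_nat.norm (Eventually.of_forall fun n => h n a)

/-- Rosenthal's `ℓ₁` theorem. -/
theorem exists_weakCauchy_subsequence [CompleteSpace X] (hX : ¬ ContainsL1 X) {u : ℕ → X}
    (hu : ∀ n, ‖u n‖ ≤ 1) :
    ∃ φ : ℕ → ℕ, StrictMono φ ∧
      ∀ f : StrongDual ℝ X, ∃ c, Tendsto (fun n => f (u (φ n))) atTop (𝓝 c) := by
  let A : ℚ → ℕ → Set {f : StrongDual ℝ X // ‖f‖ ≤ 1} := fun s n => {f | s < f.1 (u n)}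
  let B : ℚ → ℕ → Set {f : StrongDual ℝ X // ‖f‖ ≤ 1} := fun r n => {f | f.1 (u n) < r}
  -- If oscillation across a gap `q.1 < q.2` could not be removed, an independent subsequence would
  -- span `ℓ₁`. Removing it for all rational gaps leaves no functional in the ball with an
  -- oscillating sequence of values.
  have hnone : ∀ (q : ℚ × ℚ) (M : Set ℕ), M.Infinite → ∃ L ⊆ M, L.Infinite ∧
      (q.1 < q.2 → oscSet (A q.2) (B q.1) L = ∅) := by
    by_contra hcon
    push Not at hcon
    obtain ⟨q, M, hM, h⟩ := hcon
    obtain ⟨φ, hφ, hind⟩ := exists_independent_subsequence hM fun L hL hLinf =>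
      (h L hL hLinf).2
    refine hX (containsL1_of_le (w := u ∘ φ) (fun k => hu _)
      (c := ((q.2 : ℝ) - q.1) / 2) ?_ fun n a => mul_sum_abs_le_norm_sum ?_ _ a)
    · have : (q.1 : ℝ) < q.2 := by exact_mod_cast (h M subset_rfl hM).1
      linarith
    · intro P Q hPQ
      obtain ⟨f, hf1, hf2⟩ := hind P Q hPQ
      exact ⟨f.1, f.2, hf1, hf2⟩
  obtain ⟨L, -, hLinf, hL⟩ := exists_infinite_subset_forall
    (P := fun (q : ℚ × ℚ) L => q.1 < q.2 → oscSet (A q.2) (B q.1) L = ∅)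
    (fun q L M hfin hM hq => subset_empty_iff.1 (hM hq ▸ oscSet_mono _ _ hfin)) hnone infinite_univ
  obtain ⟨φ, hφ, hφL⟩ := extraction_forall_of_frequently (P := fun _ n => n ∈ L) fun _ =>
    Nat.frequently_atTop_iff_infinite.2 hLinf
  refine ⟨φ, hφ, ?_⟩
  have hball : ∀ f : StrongDual ℝ X, ‖f‖ ≤ 1 →
      ∃ c, Tendsto (fun n => f (u (φ n))) atTop (𝓝 c) := by
    intro f hf
    have hb : ∀ n, |f (u (φ n))| ≤ ‖f‖ := fun n => abs_apply_le_of_norm_le_one f (hu _)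
    refine tendsto_of_no_upcrossings Rat.denseRange_cast ?_
      (isBoundedUnder_of ⟨‖f‖, fun n => (abs_le.1 (hb n)).2⟩)
      (isBoundedUnder_of ⟨-‖f‖, fun n => (abs_le.1 (hb n)).1⟩)
    rintro _ ⟨r, rfl⟩ _ ⟨s, rfl⟩ hrs ⟨h1, h2⟩
    have hmem : (⟨f, hf⟩ : {f : StrongDual ℝ X // ‖f‖ ≤ 1}) ∈ oscSet (A s) (B r) L := by
      constructor
      · refine ((Nat.frequently_atTop_iff_infinite.1 h2).image hφ.injective.injOn).mono ?_
        rintro _ ⟨n, hn, rfl⟩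
        exact ⟨hφL n, hn⟩
      · refine ((Nat.frequently_atTop_iff_infinite.1 h1).image hφ.injective.injOn).mono ?_
        rintro _ ⟨n, hn, rfl⟩
        exact ⟨hφL n, hn⟩
    rw [hL (r, s) (by exact_mod_cast hrs)] at hmem
    exact hmem
  intro f
  obtain ⟨c, hc⟩ := hball ((‖f‖ + 1)⁻¹ • f) (by
    rw [norm_smul, norm_inv, Real.norm_of_nonneg (by positivity), inv_mul_le_iff₀ (by positivity)]
    linarith)
  refine ⟨(‖f‖ + 1) * c, (hc.const_mul (‖f‖ + 1)).congr fun n => ?_⟩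
  have : ‖f‖ + 1 ≠ 0 := by positivity
  rw [smul_apply, _root_.smul_eq_mul, mul_inv_cancel_left₀ this]

end Rosenthal

/-! ### Weakly null trees and the main equivalences -/

section Main

variable {X : Type*} [NormedAddCommGroup X] [NormedSpace ℝ X]

theorem exists_seq_tendsto_of_mem_szlenkDeriv [TopologicalSpace.SeparableSpace X] {ε : ℝ}
    (hε : 0 < ε) {L : Set (StrongDual ℝ X)} (hL : ∀ h ∈ L, ‖h‖ ≤ 1) {f : StrongDual ℝ X}
    (hf : f ∈ szlenkDeriv ε L) (hf1 : ‖f‖ ≤ 1) :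
    ∃ (h : ℕ → StrongDual ℝ X) (u : ℕ → X), (∀ n, h n ∈ L) ∧ (∀ n, ‖u n‖ ≤ 1) ∧
      (∀ n, ε / 2 < h n (u n) - f (u n)) ∧ ∀ w, Tendsto (fun n => h n w) atTop (𝓝 (f w)) := by
  classical
  obtain ⟨v, hv⟩ := exists_seq_of_isSeparable (univ_nonempty (α := X))
    (TopologicalSpace.IsSeparable.of_separableSpace univ)
  choose h hhL hnear u hu hlt using fun n : ℕ => exists_far_of_mem_szlenkDeriv hε hf
    ((Finset.range (n + 1)).image v) (Nat.one_div_pos_of_nat (α := ℝ) (n := n))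
  refine ⟨h, u, hhL, hu, hlt, fun w => ?_⟩
  rw [Metric.tendsto_atTop]
  intro δ hδ
  obtain ⟨i, hi⟩ := hv w (mem_univ w) (δ / 3) (by positivity)
  obtain ⟨N, hN⟩ := exists_nat_one_div_lt (show 0 < δ / 3 by positivity)
  have hdiff : ∀ g : StrongDual ℝ X, ‖g‖ ≤ 1 → |g w - g (v i)| < δ / 3 := by
    intro g hg
    have := g.le_of_opNorm_le hg (w - v i)
    rw [one_mul, map_sub, Real.norm_eq_abs, ← dist_eq_norm] at this
    exact this.trans_lt hi
  refine ⟨max i N, fun n hn => ?_⟩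
  have h1 := hnear n (v i) (Finset.mem_image_of_mem v
    (by have := (le_max_left i N).trans hn; simp; omega))
  have h2 := (Nat.one_div_le_one_div (α := ℝ) ((le_max_right i N).trans hn)).trans_lt hN
  have h3 := hdiff (h n) (hL _ (hhL n))
  have h4 := hdiff f hf1
  rw [Real.dist_eq]
  rw [abs_lt] at h1 h3 h4 ⊢
  constructor <;> linarith [h1.1, h1.2, h3.1, h3.2, h4.1, h4.2]

/-- Halved differences of a weakly Cauchy sequence of almost norming vectors are weakly null. The
later index `N k` is so large that its functional nearly equals `f` on the earlier vector, so
subtracting that vector does not destroy the norming. -/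
theorem exists_weaklyNull_of_mem_szlenkDeriv [CompleteSpace X]
    [TopologicalSpace.SeparableSpace X] (hX : ¬ ContainsL1 X) {ε : ℝ}
    (hε : 0 < ε) {L : Set (StrongDual ℝ X)} (hL : ∀ h ∈ L, ‖h‖ ≤ 1) {f : StrongDual ℝ X}
    (hf : f ∈ szlenkDeriv ε L) (hf1 : ‖f‖ ≤ 1) :
    ∃ (h : ℕ → StrongDual ℝ X) (x : ℕ → X), (∀ n, h n ∈ L) ∧ (∀ n, ‖x n‖ ≤ 1) ∧
      (∀ g : StrongDual ℝ X, Tendsto (fun n => g (x n)) atTop (𝓝 0)) ∧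
      (∀ᶠ n in atTop, ε / 5 < h n (x n)) ∧ ∀ w, Tendsto (fun n => h n w) atTop (𝓝 (f w)) := by
  obtain ⟨h, u, hhL, hu, hlt, hlim⟩ := exists_seq_tendsto_of_mem_szlenkDeriv hε hL hf hf1
  obtain ⟨φ, hφ, hc⟩ := exists_weakCauchy_subsequence hX hu
  have hN : ∀ k, ∃ N, k ≤ N ∧ |h (φ N) (u (φ k)) - f (u (φ k))| < ε / 30 := by
    intro k
    have := ((hlim (u (φ k))).comp hφ.tendsto_atTop).eventually
      (Metric.ball_mem_nhds _ (show 0 < ε / 30 by positivity))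
    obtain ⟨N, hN1, hN2⟩ := ((eventually_ge_atTop k).and this).exists
    exact ⟨N, hN1, by simpa [Real.dist_eq] using hN2⟩
  choose N hkN hN using hN
  have hNtop : Tendsto N atTop atTop := tendsto_atTop_mono hkN tendsto_id
  have hmid : ∀ (g : StrongDual ℝ X) k, g ((2 : ℝ)⁻¹ • (u (φ (N k)) - u (φ k))) =
      (g (u (φ (N k))) - g (u (φ k))) / 2 := by
    intro g k
    rw [map_smul, map_sub, _root_.smul_eq_mul]
    ring
  have hnull : ∀ g : StrongDual ℝ X, Tendsto
      (fun k => g ((2 : ℝ)⁻¹ • (u (φ (N k)) - u (φ k)))) atTop (𝓝 0) := by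
    intro g
    obtain ⟨c, hg⟩ := hc g
    have := ((hg.comp hNtop).sub hg).div_const 2
    rw [_root_.sub_self, _root_.zero_div] at this
    exact this.congr fun k => (hmid g k).symm
  refine ⟨fun k => h (φ (N k)), fun k => (2 : ℝ)⁻¹ • (u (φ (N k)) - u (φ k)),
    fun k => hhL _, fun k => ?_, hnull, ?_,
    fun w => (hlim w).comp (hφ.tendsto_atTop.comp hNtop)⟩
  · rw [norm_smul, Real.norm_of_nonneg (by norm_num)]
    have h1 := norm_sub_le (u (φ (N k))) (u (φ k))
    have h2 := hu (φ (N k))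
    have h3 := hu (φ k)
    linarith
  · filter_upwards [(hnull f).eventually
      (Metric.ball_mem_nhds _ (show 0 < ε / 30 by positivity))] with k hk
    rw [Real.dist_eq, _root_.sub_zero, hmid] at hk
    have h1 := hN k
    have h2 := hlt (φ (N k))
    rw [abs_lt] at hk h1
    rw [hmid]
    linarith [hk.1, hk.2, h1.1, h1.2]

theorem mem_derivIter_weaklyNull [CompleteSpace X] [TopologicalSpace.SeparableSpace X]
    (hX : ¬ ContainsL1 X) {K : Set (StrongDual ℝ X)} (hball : ∀ f ∈ K, ‖f‖ ≤ 1)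
    (hK : IsWeakStarClosed K) (S : Set (StrongDual ℝ X)) {ε : ℝ} (hε : 0 < ε) (ξ : Ordinal.{0})
    {f : StrongDual ℝ X} (hf : f ∈ derivIter (szlenkDeriv ε) K ξ) (t : List X)
    (ht : ∀ w ∈ t, ‖w‖ ≤ 1) (hft : ∀ w ∈ t, ε / 5 < f w) :
    t ∈ derivIter (seqDeriv (nullSeqs S)) (normedTree K (ε / 5)) ξ := by
  classical
  induction ξ using Ordinal.limitRecOn generalizing f t with
  | zero =>
    rw [derivIter_zero] at hf ⊢
    exact ⟨ht, f, hf, fun w hw => (hft w hw).le⟩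
  | add_one ξ ih =>
    have hfξ := derivIter_szlenkDeriv_antitone hK ε (le_self_add (b := 1)) hf
    rw [derivIter_add_one] at hf ⊢
    obtain ⟨h, x, hhL, hx, hnull, hlt, hlim⟩ := exists_weaklyNull_of_mem_szlenkDeriv hX hε
      (fun g hg => hball g (derivIter_szlenkDeriv_subset hK ε ξ hg)) hf
      (hball f (derivIter_szlenkDeriv_subset hK ε ξ hfξ))
    have hev : ∀ᶠ n in atTop, ∀ w ∈ t.toFinset, ε / 5 < h n w :=
      (eventually_all_finset _).2 fun w hw =>
        (hlim w).eventually (lt_mem_nhds (hft w (List.mem_toFinset.1 hw)))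
    obtain ⟨N, hN⟩ := eventually_atTop.1 (hev.and hlt)
    refine ⟨ih hfξ t ht hft, fun i => x (i + N), ⟨fun i => hx _, fun g _ =>
      (tendsto_add_atTop_iff_nat N).2 (hnull g)⟩, fun i => ?_⟩
    refine ih (hhL (i + N)) _ (fun w hw => ?_) fun w hw => ?_
    · rcases List.mem_append.1 hw with hw | hw
      · exact ht w hw
      · rw [List.mem_singleton.1 hw]
        exact hx _
    · rcases List.mem_append.1 hw with hw | hw
      · exact (hN (i + N) (by omega)).1 w (List.mem_toFinset.2 hw)
      · rw [List.mem_singleton.1 hw]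
        exact (hN (i + N) (by omega)).2
  | limit ξ hlim ih =>
    rw [derivIter_limit _ _ hlim] at hf ⊢
    exact mem_iInter₂.2 fun ζ hζ => ih ζ hζ (mem_iInter₂.1 hf ζ hζ) t ht hft

theorem tfae_cond [TopologicalSpace.SeparableSpace X]
    {F : Ordinal.{0} → Set (Finset ℕ)} (hF : IsFineSchreier F) {K : Set (StrongDual ℝ X)}
    (hne : K.Nonempty) (hball : ∀ f ∈ K, ‖f‖ ≤ 1) (hK : IsWeakStarCompact K) {ξ : Ordinal.{0}}
    (hξ : ξ < ω₁) :
    [condSzlenk K ξ, condTreeCont K (F ξ), condTreeMax K (F ξ), condNullIndex K ξ,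
      condRadiusIndex K ξ].TFAE := by
  tfae_have 1 → 2 := condTreeCont_of_condSzlenk hF hball hK.isWeakStarClosed hξ
  tfae_have 2 → 3 := condTreeMax_of_condTreeCont
  tfae_have 3 → 4 := condNullIndex_of_condTreeMax hF hξ
  tfae_have 4 → 5 := condRadiusIndex_of_condNullIndex hξ
  tfae_have 5 → 1 := by
    rintro ⟨r, ε, -, hrε, h⟩
    by_contra hcon
    exact hcon (condSzlenk_of_lt_radiusIndex hK subset_rfl hrε hξ
      -- Failure of `condSzlenk` makes `K` norm separable, so the hypothesis may be applied with `S
      -- = K`.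
      (h K hne (isSeparable_of_not_condSzlenk hK hξ hcon)))
  tfae_finish

/-- The Szlenk index is the supremum of the indices `I_S` if `S ⊇ K` and the Szlenk derivatives
produce `S`-null trees. -/
theorem szlenkIndex_eq_iSup_nullIndex {K S : Set (StrongDual ℝ X)} (hK : IsWeakStarCompact K)
    (hKS : K ⊆ S) (h : ∀ ξ < ω₁, condSzlenk K ξ →
      ∃ ε : ℝ, 0 < ε ∧ ξ < nullIndex S (normedTree K ε)) :
    szlenkIndex K = ⨆ ε : {ε : ℝ // 0 < ε}, nullIndex S (normedTree K ε.1) := by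
  refine iSup_eq_iSup_of_lt_iff (fun _ => derivIndex_le) (fun _ => derivIndex_le)
    fun ξ hξ => ⟨?_, ?_⟩
  · rintro ⟨ε, hε⟩
    obtain ⟨δ, hδ, hlt⟩ := h ξ hξ ⟨ε.1, ε.2, hε⟩
    exact ⟨⟨δ, hδ⟩, hlt⟩
  · rintro ⟨ε, hε⟩
    obtain ⟨δ, hδ, hlt⟩ := condSzlenk_of_lt_nullIndex hK hKS ε.2 hξ hε
    exact ⟨⟨δ, hδ⟩, hlt⟩

end Main

end Szlenk

theorem lemma5p4 {X : Type*} [NormedAddCommGroup X] [NormedSpace ℝ X] [CompleteSpace X]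
    [TopologicalSpace.SeparableSpace X]
    (F : Ordinal.{0} → Set (Finset ℕ)) (hF : Szlenk.IsFineSchreier F)
    (K : Set (StrongDual ℝ X)) (hK : K.Nonempty) (hball : ∀ f ∈ K, ‖f‖ ≤ 1)
    (hcomp : Szlenk.IsWeakStarCompact K) :
    (TopologicalSpace.IsSeparable K →
      (∀ ξ : Ordinal.{0}, 0 < ξ → ξ < ω₁ →
        [Szlenk.condSzlenk K ξ, Szlenk.condTreeCont K (F ξ), Szlenk.condTreeMax K (F ξ),
          Szlenk.condNullIndex K ξ, Szlenk.condRadiusIndex K ξ].TFAE) ∧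
      ∀ S : Set (StrongDual ℝ X), K ⊆ S → TopologicalSpace.IsSeparable S →
        Szlenk.szlenkIndex K = ⨆ ε : {ε : ℝ // 0 < ε},
          Szlenk.nullIndex S (Szlenk.normedTree K ε.1)) ∧
    (¬ Szlenk.ContainsL1 X →
      (∀ ξ : Ordinal.{0}, 0 < ξ → ξ < ω₁ →
        [Szlenk.condSzlenk K ξ, Szlenk.condTreeCont K (F ξ), Szlenk.condTreeMax K (F ξ),
          Szlenk.condNullIndex K ξ, Szlenk.condRadiusIndex K ξ].TFAE) ∧
      Szlenk.szlenkIndex K = ⨆ ε : {ε : ℝ // 0 < ε},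
          Szlenk.weakIndex (Szlenk.normedTree K ε.1)) := by
  refine ⟨fun _ => ⟨fun ξ _ hξ => Szlenk.tfae_cond hF hK hball hcomp hξ, fun S hKS hS => ?_⟩,
    fun hX => ⟨fun ξ _ hξ => Szlenk.tfae_cond hF hK hball hcomp hξ, ?_⟩⟩
  · refine Szlenk.szlenkIndex_eq_iSup_nullIndex hcomp hKS fun ξ hξ h => ?_
    obtain ⟨ε, hε, hlt⟩ := ((Szlenk.tfae_cond hF hK hball hcomp hξ).out 0 3).1 h
    exact ⟨ε, hε, hlt S (hK.mono hKS) hS⟩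
  -- The dual ball contains `K` but may be nonseparable, so the equivalences do not supply null
  -- trees for it; the weakly null construction does, starting from the empty list.
  · refine Szlenk.szlenkIndex_eq_iSup_nullIndex hcomp hball fun ξ hξ h => ?_
    obtain ⟨ε, hε, hlt⟩ := h
    obtain ⟨f, hf⟩ := Szlenk.derivIter_nonempty hξ hlt
    refine ⟨ε / 5, by positivity, Szlenk.lt_seqIndex hξ ⟨[], ?_⟩⟩
    exact Szlenk.mem_derivIter_weaklyNull hX hball hcomp.isWeakStarClosed _ hε ξ hf []
      (by simp) (by simp)
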